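/- Setting. Let $n\ge 2$, $\Delta_n=\{p\in(0,1)^n:\sum_i p_i=1\}$ and $\Delta_{n,\ge}=\{u\in\Delta_n:u_1\ge\cdots\ge u_n\}$. For $u\in\Delta_{n,\ge}$ and $r\in\Delta_n$ put $(u\oplus r)_k=u_kr_k/(u\cdot r)$. For a function $\ell:[0,1]\to\mathbb{R}$ with derivative $\ell'$ let $$\pi_i(p)=p_i\Big(1+\tfrac1n\ell'(p_i)-\tfrac1n\sum_{j=1}^n p_j\ell'(p_j)\Big),\qquad \mathcal L(u,r;\ell)=\log\frac{\pi(u)\cdot r}{u\cdot r},\qquad D_\ell[v:u]=\frac1n\sum_{k=1}^n(\ell(v_k)-\ell(u_k)).$$ Fix $\beta>0$. Let $\mathcal E_\beta$ be the set of $C^1$ functions $\ell$ on $[0,1]$ such that $e^{\ell}$ is concave, $\ell(\tfrac12)=0$, and $\ell'$ is Lipschitz on $[0,1]$ with constant $\beta$. For a Borel probability measure $\gamma$ on $\Delta_{n,\ge}\times\Delta_n$, $\eta_0\in\mathbb R$ and $\eta_1>0$, let $$J(\ell;\gamma)=\int\big\{\eta_0D_\ell[u\oplus r:u]+\eta_1\mathcal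 L(u,r;\ell)\big\}\,d\gamma(u,r),\qquad J(\gamma)=\sup_{\ell\in\mathcal E_\beta}J(\ell;\gamma).$$ Discretization. Let $\mathcal P=\{0=x_1<\cdots<x_d=1\}$ be a partition with $\tfrac12\in\mathcal P$, $\delta=\max_i(x_{i+1}-x_i)$ and $\underline\delta=\min_i(x_{i+1}-x_i)$. For a vector $v\in\mathbb R^d$ let $\hat v$ be the function on $[0,1]$ that is affine on each $[x_i,x_{i+1}]$ with $\hat v(x_i)=v_i$; at each interior node $\hat v'$ is taken to be either the left or the right derivative, according to any choice fixed in advance and common to all $v$. Let $\hat J(v;\gamma)=J(\hat v;\gamma)$ and $\Delta_iv=(v_{i+1}-v_i)/(x_{i+1}-x_i)$ for $1\le i\le d-1$. The discretized problem is to maximize $\hat J(v;\gamma)$ over all $v\in\mathbb R^d$ subject to $$-v_i+\log\big(w_ie^{v_{i+1}}+(1-w_i)e^{v_{i-1}}\big)\le0,\quad w_i=\frac{x_i-x_{i-1}}{x_{i+1}-x_{i-1}},\quad 2\le i\le d-1,$$ $$-(\Delta_{i+1}v-\Delta_iv)-\tfrac\beta2(x_{i+2}-x_i)\le0,\quad 1\le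 i\le d-2,$$ $$(\Delta_1v)^2\le\beta,\qquad(\Delta_{d-1}v)^2\le\beta,\qquad\hat v(\tfrac12)=0.$$ Theorem. Let $M>0$. For every $\alpha\in(0,1)$ there is $\delta_{0,\alpha}>0$, depending only on $\alpha,\beta,M,n$, and for all $\eta_0\in\mathbb R$, $\eta_1>0$ there is a constant $K>0$, depending only on $\beta,M,n$ and the weights $\eta_0,\eta_1$ (in particular not on $\alpha$, $\gamma$ or $\mathcal P$), such that the following holds for every $\alpha\in(0,1)$, every Borel probability measure $\gamma$ on $\Delta_{n,\ge}\times\Delta_n$ and every partition $\mathcal P$ as above with $|\delta-\underline\delta|\le M\underline\delta^3$ and $\underline\delta<\delta_{0,\alpha}$. Both objectives are well defined on their feasible sets (the logarithms have positive arguments and the integrands are integrable), $J(\gamma)$ is finite, the discretized problem has an optimal solution, and every optimal solution $v^*$ of it satisfies $$\big|J(\gamma)-\hat J(v^*;\gamma)\big|\le K\underline\delta^{\alpha}\le K\delta^{\alpha}.$$ -/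

import Mathlib

open MeasureTheory
open scoped BigOperators

noncomputable section

namespace RankPortfolio

/-! ### Simplices and the data space -/

/-- The open unit simplex `Δ_n`. -/
def openSimplex (n : ℕ) : Set (Fin n → ℝ) :=
  {p | (∀ i, p i ∈ Set.Ioo (0 : ℝ) 1) ∧ ∑ i, p i = 1}

/-- The ordered open unit simplex `Δ_{n,≥}`: points of `Δ_n` with `u_1 ≥ ⋯ ≥ u_n`. -/
def orderedSimplex (n : ℕ) : Set (Fin n → ℝ) :=
  {u | u ∈ openSimplex n ∧ Antitone u}

/-- The data space `Δ_{n,≥} × Δ_n` of pairs `(u, r)`, with its Borel structure. -/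
abbrev DataSpace (n : ℕ) : Type := orderedSimplex n × openSimplex n

/-- Aitchison addition `(a ⊕ b)_k = a_k b_k / (a · b)`. -/
def aitchisonAdd {n : ℕ} (a b : Fin n → ℝ) : Fin n → ℝ :=
  fun k => a k * b k / ∑ i, a i * b i

/-! ### The objective function

The functionals below take a generating function `ℓ` and its derivative as two arguments, since a
piecewise affine `ℓ` needs a convention for its derivative at the mesh points. -/

/-- The portfolio weights
`π_i(p) = p_i (1 + ℓ'(p_i)/n - (1/n) ∑_j p_j ℓ'(p_j))`; the argument `dl` is `ℓ'`. -/
def portfolio {n : ℕ} (dl : ℝ → ℝ) (p : Fin n → ℝ) (i : Fin n) : ℝ :=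
  p i * (1 + (1 / (n : ℝ)) * dl (p i) - (1 / (n : ℝ)) * ∑ j, p j * dl (p j))

/-- The relative gross return `(π(u) · r) / (u · r)`. -/
def grossReturn {n : ℕ} (dl : ℝ → ℝ) (u r : Fin n → ℝ) : ℝ :=
  (∑ i, portfolio dl u i * r i) / ∑ i, u i * r i

/-- The relative log return `𝓛(u, r; ℓ) = log ((π(u) · r) / (u · r))`. -/
def logReturn {n : ℕ} (dl : ℝ → ℝ) (u r : Fin n → ℝ) : ℝ :=
  Real.log (grossReturn dl u r)

/-- The diversity contribution `D_ℓ[v : u] = (1/n) ∑_k (ℓ(v_k) - ℓ(u_k))`. -/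
def diversity {n : ℕ} (l : ℝ → ℝ) (v u : Fin n → ℝ) : ℝ :=
  (1 / (n : ℝ)) * ∑ k, (l (v k) - l (u k))

/-- The integrand `η₀ D_ℓ[u ⊕ r : u] + η₁ 𝓛(u, r; ℓ)`. -/
def reward {n : ℕ} (η₀ η₁ : ℝ) (l dl : ℝ → ℝ) (z : DataSpace n) : ℝ :=
  η₀ * diversity l (aitchisonAdd (z.1 : Fin n → ℝ) (z.2 : Fin n → ℝ)) (z.1 : Fin n → ℝ)
    + η₁ * logReturn dl (z.1 : Fin n → ℝ) (z.2 : Fin n → ℝ)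

/-- The integral of the reward against the data measure. -/
def objective {n : ℕ} (η₀ η₁ : ℝ) (γ : Measure (DataSpace n)) (l dl : ℝ → ℝ) : ℝ :=
  ∫ z, reward η₀ η₁ l dl z ∂γ

/-- The objective is genuinely defined at `(ℓ, ℓ')`: the logarithm is evaluated at positive numbers
only, and the reward is integrable. -/
def ObjectiveDefined {n : ℕ} (η₀ η₁ : ℝ) (γ : Measure (DataSpace n)) (l dl : ℝ → ℝ) : Prop :=
  (∀ z : DataSpace n, 0 < grossReturn dl (z.1 : Fin n → ℝ) (z.2 : Fin n → ℝ)) ∧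
    Integrable (reward η₀ η₁ l dl) γ

/-! ### The original problem -/

/-- The derivative of a function on `[0, 1]`, one-sided at the endpoints. -/
def derivUnit (l : ℝ → ℝ) : ℝ → ℝ := derivWithin l (Set.Icc 0 1)

/-- The class `𝓔_β`: functions that are `C¹` on `[0, 1]`, exponentially concave, vanish at `1/2`,
and have a `β`-Lipschitz derivative. Values outside `[0, 1]` play no role. -/
def smoothClass (β : ℝ) : Set (ℝ → ℝ) :=
  {l | ContDiffOn ℝ 1 l (Set.Icc 0 1) ∧
    ConcaveOn ℝ (Set.Icc 0 1) (fun x => Real.exp (l x)) ∧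
    l (1 / 2) = 0 ∧
    ∀ x ∈ Set.Icc (0 : ℝ) 1, ∀ y ∈ Set.Icc (0 : ℝ) 1,
      |derivUnit l x - derivUnit l y| ≤ β * |x - y|}

/-- `J(ℓ; γ)` for a differentiable generating function. -/
def continuousObjective {n : ℕ} (η₀ η₁ : ℝ) (γ : Measure (DataSpace n)) (l : ℝ → ℝ) : ℝ :=
  objective η₀ η₁ γ l (derivUnit l)

/-- The set of values `J(ℓ; γ)`, `ℓ ∈ 𝓔_β`. -/
def continuousValues {n : ℕ} (β η₀ η₁ : ℝ) (γ : Measure (DataSpace n)) : Set ℝ :=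
  continuousObjective η₀ η₁ γ '' smoothClass β

/-- The optimal value `J(γ) = sup_{ℓ ∈ 𝓔_β} J(ℓ; γ)`. -/
def optimalValue {n : ℕ} (β η₀ η₁ : ℝ) (γ : Measure (DataSpace n)) : ℝ :=
  sSup (continuousValues β η₀ η₁ γ)

/-! ### Partitions of the unit interval -/

/-- A partition `0 = x_0 < x_1 < ⋯ < x_{m+1} = 1` of `[0, 1]`, having `1/2` among its nodes. It has
`m + 2` nodes, `m` interior nodes and `m + 1` cells. -/
structure MeshPartition (m : ℕ) where
  node : Fin (m + 2) → ℝ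
  strictMono_node : StrictMono node
  node_zero : node 0 = 0
  node_last : node (Fin.last (m + 1)) = 1
  half_mem : ∃ i, node i = 1 / 2

namespace MeshPartition

variable {m : ℕ} (P : MeshPartition m)

/-- The length of the `i`-th cell. -/
def width (i : Fin (m + 1)) : ℝ := P.node i.succ - P.node i.castSucc

/-- The mesh size `δ`, the maximal cell length. -/
def mesh : ℝ := ⨆ i, P.width i

/-- The minimal cell length. -/
def minMesh : ℝ := ⨅ i, P.width i

/-- The closed `i`-th cell. -/
def cell (i : Fin (m + 1)) : Set ℝ := Set.Icc (P.node i.castSucc) (P.node i.succ)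

/-- The difference quotient `Δ_i ℓ` of a vector of nodal values over the `i`-th cell. -/
def slope (v : Fin (m + 2) → ℝ) (i : Fin (m + 1)) : ℝ :=
  (v i.succ - v i.castSucc) / (P.node i.succ - P.node i.castSucc)

/-- The last cell whose left endpoint is at most `x`. -/
def rightCell (x : ℝ) : Fin (m + 1) :=
  (Finset.univ.filter fun i : Fin (m + 1) => P.node i.castSucc ≤ x).sup id

/-- The piecewise affine function with the nodal values `v`. -/
def interp (v : Fin (m + 2) → ℝ) (x : ℝ) : ℝ :=
  v (P.rightCell x).castSucc + P.slope v (P.rightCell x) * (x - P.node (P.rightCell x).castSucc)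

/-- A map that assigns to each point of `[0, 1]` a closed cell containing it. It is forced inside
the cells and at `0` and `1`; at an interior node it picks one of the two neighbouring cells, that
is, it decides between the left and the right derivative. -/
def IsCellSelection (c : ℝ → Fin (m + 1)) : Prop :=
  ∀ x ∈ Set.Icc (0 : ℝ) 1, x ∈ P.cell (c x)

/-- The derivative of the piecewise affine function with nodal values `v`, with one-sided
derivatives at the nodes chosen by `c`. -/
def interpDeriv (c : ℝ → Fin (m + 1)) (v : Fin (m + 2) → ℝ) (x : ℝ) : ℝ := P.slope v (c x)

theorem isCellSelection_rightCell : P.IsCellSelection P.rightCell := by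
  intro x hx
  have hne : (Finset.univ.filter fun i : Fin (m + 1) => P.node i.castSucc ≤ x).Nonempty := by
    refine ⟨0, ?_⟩
    simp [P.node_zero, hx.1]
  have hmem : P.rightCell x ∈
      Finset.univ.filter fun i : Fin (m + 1) => P.node i.castSucc ≤ x := by
    obtain ⟨i, hi, h⟩ := Finset.exists_mem_eq_sup _ hne (id : Fin (m + 1) → Fin (m + 1))
    unfold rightCell
    rw [h]
    exact hi
  refine ⟨by simpa using hmem, ?_⟩
  by_contra hlt
  push Not at hlt
  by_cases hl : P.rightCell x = Fin.last m
  · rw [hl, Fin.succ_last, P.node_last] at hlt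
    exact absurd hx.2 (not_le.mpr hlt)
  · have hlt' : (P.rightCell x).val < m := by
      have h1 := (P.rightCell x).isLt
      have h2 : (P.rightCell x).val ≠ m := fun h => hl (Fin.ext h)
      omega
    let k : Fin (m + 1) := ⟨(P.rightCell x).val + 1, by omega⟩
    have hk : k.castSucc = (P.rightCell x).succ := Fin.ext rfl
    have hkm : k ∈ Finset.univ.filter fun i : Fin (m + 1) => P.node i.castSucc ≤ x := by
      simp only [Finset.mem_filter, Finset.mem_univ, true_and]
      rw [hk]
      exact hlt.le
    have hle : k ≤ P.rightCell x := Finset.le_sup (f := id) hkm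
    have : (P.rightCell x).val + 1 ≤ (P.rightCell x).val := hle
    omega

/-- On each closed cell, `interp` is the affine function through the two nodal values. -/
theorem interp_eq_of_mem (v : Fin (m + 2) → ℝ) {x : ℝ} {i : Fin (m + 1)} (hx : x ∈ P.cell i) :
    P.interp v x = v i.castSucc + P.slope v i * (x - P.node i.castSucc) := by
  have h0 : (0 : ℝ) ≤ P.node i.castSucc := by
    rw [← P.node_zero]
    exact P.strictMono_node.monotone (Fin.zero_le _)
  have h1 : P.node i.succ ≤ 1 := by
    rw [← P.node_last]
    exact P.strictMono_node.monotone (Fin.le_last _)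
  have hs := P.isCellSelection_rightCell x ⟨h0.trans hx.1, hx.2.trans h1⟩
  unfold interp
  by_cases he : P.rightCell x = i
  · rw [he]
  · have hle : i ≤ P.rightCell x :=
      Finset.le_sup (f := id) (by simpa using hx.1)
    have hlt : i < P.rightCell x := lt_of_le_of_ne hle (Ne.symm he)
    have hn : i.succ ≤ (P.rightCell x).castSucc := by
      rw [Fin.le_def]
      exact hlt
    have hmono := P.strictMono_node.monotone hn
    have hx' : x = P.node i.succ := le_antisymm hx.2 (hmono.trans hs.1)
    have heq : (P.rightCell x).castSucc = i.succ :=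
      P.strictMono_node.injective (le_antisymm (hs.1.trans hx.2) hmono)
    have hw : P.node i.succ - P.node i.castSucc ≠ 0 :=
      sub_ne_zero.mpr (P.strictMono_node (Fin.castSucc_lt_succ)).ne'
    rw [heq]
    unfold slope
    rw [← hx'] at hw ⊢
    field_simp
    ring

/-! ### The discretized problem -/

/-- The constraints of the discretized problem: discrete exponential concavity and the discrete
`β`-smoothness constraint at the interior nodes, the slope bounds on the first and the last cell,
and the normalization at `1/2`. -/
def Feasible (β : ℝ) (v : Fin (m + 2) → ℝ) : Prop :=
  (∀ i : Fin m,
    -v i.succ.castSucc + Real.log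
      ((P.node i.succ.castSucc - P.node i.castSucc.castSucc) /
          (P.node i.succ.succ - P.node i.castSucc.castSucc) * Real.exp (v i.succ.succ) +
        (1 - (P.node i.succ.castSucc - P.node i.castSucc.castSucc) /
          (P.node i.succ.succ - P.node i.castSucc.castSucc)) * Real.exp (v i.castSucc.castSucc))
      ≤ 0) ∧
  (∀ i : Fin m,
    -(P.slope v i.succ - P.slope v i.castSucc)
      - β / 2 * (P.node i.succ.succ - P.node i.castSucc.castSucc) ≤ 0) ∧
  P.slope v 0 ^ 2 - β ≤ 0 ∧
  P.slope v (Fin.last m) ^ 2 - β ≤ 0 ∧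
  P.interp v (1 / 2) = 0

/-- The objective `Ĵ(v; γ)` of the discretized problem. -/
def discreteObjective {n : ℕ} (c : ℝ → Fin (m + 1)) (η₀ η₁ : ℝ) (γ : Measure (DataSpace n))
    (v : Fin (m + 2) → ℝ) : ℝ :=
  objective η₀ η₁ γ (P.interp v) (P.interpDeriv c v)

/-- `v` is an optimal solution of the discretized problem. -/
def IsOptimizer {n : ℕ} (c : ℝ → Fin (m + 1)) (β η₀ η₁ : ℝ) (γ : Measure (DataSpace n))
    (v : Fin (m + 2) → ℝ) : Prop :=
  P.Feasible β v ∧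
    ∀ w, P.Feasible β w → P.discreteObjective c η₀ η₁ γ w ≤ P.discreteObjective c η₀ η₁ γ v

end MeshPartition

end RankPortfolio

end

open RankPortfolio

/-!
The error is of first order in the mesh size `δ`; the exponent `α < 1` enters only through
`δ_min ≤ δ_min ^ α`, and the quasi-uniformity of the partition only through `δ ≤ 2 δ_min`.

*Stability of the objective.* The ratio `π_i(u) / u_i` is the average over `k` of the tangent values
`1 + ℓ'(u_k) (δ_{ik} - u_k)`. If these stay above some `κ > 0` (`IsAdmissible`), so does the gross
return, and the reward is bounded and Lipschitz in `(ℓ, ℓ')` for the uniform norm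
(`abs_reward_sub_le`). For `ℓ` in `𝓔_β` the tangent inequality of the concave function `e^ℓ` gives
`e^{ℓ(y) - ℓ(x)} ≤ 1 + ℓ'(x) (y - x)`. The product of two such inequalities gives `ℓ'² ≤ β`, hence
`κ = e^{-√β}` is possible. It therefore suffices to approximate members of `𝓔_β` by feasible
vectors and conversely, with an error `O(δ)` in the derivative.

*From functions to vectors.* The nodal values of a member of `𝓔_β` satisfy all discrete constraints
exactly (`feasible_of_mem_smoothClass`).

*From vectors to functions.* Let `g` be the piecewise affine function through the points
(midpoint of a cell, slope of `v` on the cell), with the extreme pieces extended to `0` and `1`. The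
slopes decrease, and the discrete smoothness constraint then says precisely that `g` is
`β`-Lipschitz; a Taylor expansion of discrete exponential concavity gives `g' + g² ≤ C δ`
(`IsSlopeInterpolant.secondSlope_add_sq_le`). The class of functions with `g' + g² ≤ 0` and
`|g'| ≤ β` is convex, and `x ↦ -b (x - 1/2)` with `b = min β 1` is a member with strict inequality
in the former condition, so a convex combination with weight `O(δ)` on this function removes the
error; its primitive belongs to `𝓔_β` (`exists_mem_smoothClass_near`). The nearby member of `𝓔_β`
also supplies the lower bound `κ` for feasible vectors. Optimal vectors exist because the feasible
set is compact and the objective is continuous on it.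
-/

namespace RankPortfolio

/-! ### Boundedness and stability of the reward -/

/-- `ℓ` and its derivative `dl` are bounded by `B` on `[0, 1]`, and the tangents of slope `dl x`
stay above `κ` at both endpoints: `κ ≤ 1 + dl x (y - x)` for `y = 0` and `y = 1`. -/
structure IsAdmissible (B κ : ℝ) (l dl : ℝ → ℝ) : Prop where
  abs_le : ∀ x ∈ Set.Icc (0 : ℝ) 1, |l x| ≤ B
  abs_deriv_le : ∀ x ∈ Set.Icc (0 : ℝ) 1, |dl x| ≤ B
  le_tangent_zero : ∀ x ∈ Set.Icc (0 : ℝ) 1, κ ≤ 1 - dl x * x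
  le_tangent_one : ∀ x ∈ Set.Icc (0 : ℝ) 1, κ ≤ 1 + dl x * (1 - x)

theorem IsAdmissible.mono {B κ κ' : ℝ} {l dl : ℝ → ℝ} (h : IsAdmissible B κ l dl) (hκ : κ' ≤ κ) :
    IsAdmissible B κ' l dl :=
  ⟨h.abs_le, h.abs_deriv_le, fun x hx => hκ.trans (h.le_tangent_zero x hx),
    fun x hx => hκ.trans (h.le_tangent_one x hx)⟩

variable {n : ℕ}

theorem mem_Icc_of_mem_openSimplex {p : Fin n → ℝ} (hp : p ∈ openSimplex n) (k : Fin n) :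
    p k ∈ Set.Icc (0 : ℝ) 1 :=
  ⟨(hp.1 k).1.le, (hp.1 k).2.le⟩

theorem pos_of_mem_openSimplex {p : Fin n → ℝ} (hp : p ∈ openSimplex n) : 0 < n := by
  rcases Nat.eq_zero_or_pos n with rfl | h
  · have := hp.2
    simp at this
  · exact h

theorem sum_mul_pos {u r : Fin n → ℝ} (hu : u ∈ openSimplex n) (hr : r ∈ openSimplex n) :
    0 < ∑ i, u i * r i := by
  have hn := pos_of_mem_openSimplex hu
  have : Nonempty (Fin n) := ⟨⟨0, hn⟩⟩
  exact Finset.sum_pos (fun i _ => mul_pos (hu.1 i).1 (hr.1 i).1) Finset.univ_nonempty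

theorem aitchisonAdd_mem_Icc {u r : Fin n → ℝ} (hu : u ∈ openSimplex n) (hr : r ∈ openSimplex n)
    (k : Fin n) : aitchisonAdd u r k ∈ Set.Icc (0 : ℝ) 1 := by
  have hpos := sum_mul_pos hu hr
  have h0 : ∀ i, 0 ≤ u i * r i := fun i => (mul_pos (hu.1 i).1 (hr.1 i).1).le
  refine ⟨div_nonneg (h0 k) hpos.le, ?_⟩
  unfold aitchisonAdd
  rw [div_le_one hpos]
  exact Finset.single_le_sum (f := fun i => u i * r i) (fun i _ => h0 i) (Finset.mem_univ k)

/-- The factor `π_i(p) / p_i`. -/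
noncomputable def weightFactor (dl : ℝ → ℝ) (p : Fin n → ℝ) (i : Fin n) : ℝ :=
  1 + (1 / (n : ℝ)) * dl (p i) - (1 / (n : ℝ)) * ∑ j, p j * dl (p j)

theorem grossReturn_eq (dl : ℝ → ℝ) (u r : Fin n → ℝ) :
    grossReturn dl u r = (∑ i, weightFactor dl u i * (u i * r i)) / ∑ i, u i * r i := by
  unfold grossReturn portfolio weightFactor
  congr 1
  exact Finset.sum_congr rfl fun i _ => by ring

/-- `π_i(p) / p_i` is the average over `k` of the tangent values `1 + ℓ'(p_k) (δ_{ik} - p_k)`. -/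
theorem le_weightFactor {κ : ℝ} {dl : ℝ → ℝ} {p : Fin n → ℝ} (hp : p ∈ openSimplex n)
    (h0 : ∀ x ∈ Set.Icc (0 : ℝ) 1, κ ≤ 1 - dl x * x)
    (h1 : ∀ x ∈ Set.Icc (0 : ℝ) 1, κ ≤ 1 + dl x * (1 - x)) (i : Fin n) :
    κ ≤ weightFactor dl p i := by
  have hn : (0 : ℝ) < n := by exact_mod_cast pos_of_mem_openSimplex hp
  have key : (n : ℝ) * κ ≤ ∑ k, (1 + dl (p k) * ((if i = k then 1 else 0) - p k)) := by
    have : ∑ _k : Fin n, κ = (n : ℝ) * κ := by simp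
    rw [← this]
    refine Finset.sum_le_sum fun k _ => ?_
    have hk := mem_Icc_of_mem_openSimplex hp k
    split_ifs
    · exact h1 _ hk
    · have := h0 _ hk
      linarith
  have hsum : ∑ k, (1 + dl (p k) * ((if i = k then 1 else 0) - p k)) =
      n * weightFactor dl p i := by
    have : ∀ k, 1 + dl (p k) * ((if i = k then (1 : ℝ) else 0) - p k) =
        1 + (if i = k then dl (p k) else 0) - p k * dl (p k) := by
      intro k
      split_ifs <;> ring
    simp only [this, Finset.sum_sub_distrib, Finset.sum_add_distrib, Finset.sum_ite_eq]
    unfold weightFactor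
    simp
    field_simp
  rw [hsum] at key
  exact le_of_mul_le_mul_left key hn

theorem abs_weightFactor_sub_le {ε : ℝ} {dl dl' : ℝ → ℝ} {p : Fin n → ℝ}
    (hp : p ∈ openSimplex n) (h : ∀ x ∈ Set.Icc (0 : ℝ) 1, |dl x - dl' x| ≤ ε) (i : Fin n) :
    |weightFactor dl p i - weightFactor dl' p i| ≤ 2 * ε := by
  have hn1 : (1 : ℝ) ≤ n := by exact_mod_cast pos_of_mem_openSimplex hp
  have hi := h _ (mem_Icc_of_mem_openSimplex hp i)
  have hε : 0 ≤ ε := (abs_nonneg _).trans hi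
  have hs : |∑ j, p j * (dl (p j) - dl' (p j))| ≤ ε := by
    calc |∑ j, p j * (dl (p j) - dl' (p j))|
        ≤ ∑ j, |p j * (dl (p j) - dl' (p j))| := Finset.abs_sum_le_sum_abs _ _
      _ ≤ ∑ j, p j * ε := by
          refine Finset.sum_le_sum fun j _ => ?_
          rw [abs_mul, abs_of_pos (hp.1 j).1]
          exact mul_le_mul_of_nonneg_left (h _ (mem_Icc_of_mem_openSimplex hp j)) (hp.1 j).1.le
      _ = ε := by rw [← Finset.sum_mul, hp.2, one_mul]
  have heq : weightFactor dl p i - weightFactor dl' p i =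
      1 / (n : ℝ) * ((dl (p i) - dl' (p i)) - ∑ j, p j * (dl (p j) - dl' (p j))) := by
    unfold weightFactor
    simp only [mul_sub, Finset.sum_sub_distrib]
    ring
  rw [heq, abs_mul, abs_of_nonneg (by positivity)]
  have h1n : 1 / (n : ℝ) ≤ 1 := by
    rw [div_le_one (by linarith)]
    exact hn1
  calc 1 / (n : ℝ) * |(dl (p i) - dl' (p i)) - ∑ j, p j * (dl (p j) - dl' (p j))|
      ≤ 1 * (|dl (p i) - dl' (p i)| + |∑ j, p j * (dl (p j) - dl' (p j))|) :=
        mul_le_mul h1n (abs_sub _ _) (abs_nonneg _) zero_le_one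
    _ ≤ 2 * ε := by linarith

theorem le_grossReturn {κ : ℝ} {dl : ℝ → ℝ} {u r : Fin n → ℝ} (hu : u ∈ openSimplex n)
    (hr : r ∈ openSimplex n) (h0 : ∀ x ∈ Set.Icc (0 : ℝ) 1, κ ≤ 1 - dl x * x)
    (h1 : ∀ x ∈ Set.Icc (0 : ℝ) 1, κ ≤ 1 + dl x * (1 - x)) :
    κ ≤ grossReturn dl u r := by
  rw [grossReturn_eq, le_div_iff₀ (sum_mul_pos hu hr), Finset.mul_sum]
  exact Finset.sum_le_sum fun i _ => mul_le_mul_of_nonneg_right (le_weightFactor hu h0 h1 i)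
    (mul_pos (hu.1 i).1 (hr.1 i).1).le

theorem abs_grossReturn_sub_le {ε : ℝ} {dl dl' : ℝ → ℝ} {u r : Fin n → ℝ}
    (hu : u ∈ openSimplex n) (hr : r ∈ openSimplex n)
    (h : ∀ x ∈ Set.Icc (0 : ℝ) 1, |dl x - dl' x| ≤ ε) :
    |grossReturn dl u r - grossReturn dl' u r| ≤ 2 * ε := by
  have hpos := sum_mul_pos hu hr
  rw [grossReturn_eq, grossReturn_eq, ← sub_div, abs_div, abs_of_pos hpos, div_le_iff₀ hpos,
    ← Finset.sum_sub_distrib, Finset.mul_sum]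
  refine (Finset.abs_sum_le_sum_abs _ _).trans (Finset.sum_le_sum fun i _ => ?_)
  have hi := mul_pos (hu.1 i).1 (hr.1 i).1
  rw [← sub_mul, abs_mul, abs_of_pos hi]
  exact mul_le_mul_of_nonneg_right (abs_weightFactor_sub_le hu h i) hi.le

theorem abs_log_sub_log_le {κ a b : ℝ} (hκ : 0 < κ) (ha : κ ≤ a) (hb : κ ≤ b) :
    |Real.log a - Real.log b| ≤ |a - b| / κ := by
  have main : ∀ a b : ℝ, κ ≤ a → κ ≤ b → Real.log a - Real.log b ≤ |a - b| / κ := by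
    intro a b ha hb
    have ha0 : 0 < a := hκ.trans_le ha
    have hb0 : 0 < b := hκ.trans_le hb
    calc Real.log a - Real.log b = Real.log (a / b) := (Real.log_div ha0.ne' hb0.ne').symm
      _ ≤ a / b - 1 := Real.log_le_sub_one_of_pos (div_pos ha0 hb0)
      _ = (a - b) / b := by field_simp
      _ ≤ |a - b| / b := by gcongr; exact le_abs_self _
      _ ≤ |a - b| / κ := by gcongr
  rw [abs_le]
  constructor
  · have := main b a hb ha
    rw [abs_sub_comm] at this
    linarith
  · exact main a b ha hb

theorem abs_diversity_sub_le {ε : ℝ} {l l' : ℝ → ℝ} {v u : Fin n → ℝ} (hn : 0 < n)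
    (hv : ∀ k, v k ∈ Set.Icc (0 : ℝ) 1) (hu : ∀ k, u k ∈ Set.Icc (0 : ℝ) 1)
    (h : ∀ x ∈ Set.Icc (0 : ℝ) 1, |l x - l' x| ≤ ε) :
    |diversity l v u - diversity l' v u| ≤ 2 * ε := by
  have hn0 : (0 : ℝ) < n := by exact_mod_cast hn
  unfold diversity
  rw [← mul_sub, ← Finset.sum_sub_distrib, abs_mul, abs_of_nonneg (by positivity), one_div,
    inv_mul_le_iff₀ hn0]
  calc |∑ k, ((l (v k) - l (u k)) - (l' (v k) - l' (u k)))|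
      ≤ ∑ k, |(l (v k) - l (u k)) - (l' (v k) - l' (u k))| := Finset.abs_sum_le_sum_abs _ _
    _ ≤ ∑ _k : Fin n, 2 * ε := by
        refine Finset.sum_le_sum fun k _ => ?_
        have h1 := abs_le.mp (h _ (hv k))
        have h2 := abs_le.mp (h _ (hu k))
        rw [abs_le]
        constructor <;> linarith [h1.1, h1.2, h2.1, h2.2]
    _ = n * (2 * ε) := by simp

/-- The reward is Lipschitz in `(ℓ, ℓ')` for the uniform norm, because the gross return stays
above `κ`, where the logarithm is `κ⁻¹`-Lipschitz. -/
theorem abs_reward_sub_le {κ ε₀ ε₁ η₀ η₁ : ℝ} {l dl l' dl' : ℝ → ℝ}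
    (hκ : 0 < κ) (hη₁ : 0 ≤ η₁)
    (h0 : ∀ x ∈ Set.Icc (0 : ℝ) 1, κ ≤ 1 - dl x * x)
    (h1 : ∀ x ∈ Set.Icc (0 : ℝ) 1, κ ≤ 1 + dl x * (1 - x))
    (h0' : ∀ x ∈ Set.Icc (0 : ℝ) 1, κ ≤ 1 - dl' x * x)
    (h1' : ∀ x ∈ Set.Icc (0 : ℝ) 1, κ ≤ 1 + dl' x * (1 - x))
    (hl : ∀ x ∈ Set.Icc (0 : ℝ) 1, |l x - l' x| ≤ ε₀)
    (hdl : ∀ x ∈ Set.Icc (0 : ℝ) 1, |dl x - dl' x| ≤ ε₁) (z : DataSpace n) :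
    |reward η₀ η₁ l dl z - reward η₀ η₁ l' dl' z| ≤ |η₀| * (2 * ε₀) + η₁ * (2 * ε₁ / κ) := by
  obtain ⟨⟨u, hu, hua⟩, ⟨r, hr⟩⟩ := z
  have hD := abs_diversity_sub_le (pos_of_mem_openSimplex hu) (aitchisonAdd_mem_Icc hu hr)
    (mem_Icc_of_mem_openSimplex hu) hl
  have hL : |logReturn dl u r - logReturn dl' u r| ≤ 2 * ε₁ / κ :=
    (abs_log_sub_log_le hκ (le_grossReturn hu hr h0 h1) (le_grossReturn hu hr h0' h1')).trans
      (div_le_div_of_nonneg_right (abs_grossReturn_sub_le hu hr hdl) hκ.le)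
  have heq : reward η₀ η₁ l dl (⟨u, hu, hua⟩, ⟨r, hr⟩) - reward η₀ η₁ l' dl' (⟨u, hu, hua⟩, ⟨r, hr⟩)
      = η₀ * (diversity l (aitchisonAdd u r) u - diversity l' (aitchisonAdd u r) u)
        + η₁ * (logReturn dl u r - logReturn dl' u r) := by
    unfold reward
    ring
  rw [heq]
  refine (abs_add_le _ _).trans (add_le_add ?_ ?_)
  · rw [abs_mul]
    exact mul_le_mul_of_nonneg_left hD (abs_nonneg _)
  · rw [abs_mul, abs_of_nonneg hη₁]
    exact mul_le_mul_of_nonneg_left hL hη₁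

/-- An admissible reward is bounded: compare it with the reward of `ℓ = 0`, which vanishes. -/
theorem IsAdmissible.abs_reward_le {B κ η₀ η₁ : ℝ} {l dl : ℝ → ℝ} (h : IsAdmissible B κ l dl)
    (hκ : 0 < κ) (hη₁ : 0 ≤ η₁) (z : DataSpace n) :
    |reward η₀ η₁ l dl z| ≤ |η₀| * (2 * B) + η₁ * (2 * B / κ) := by
  have hκ1 : κ ≤ 1 := by
    have := h.le_tangent_zero 0 (by simp)
    simpa using this
  have h0 : reward η₀ η₁ (fun _ => 0) (fun _ => 0) z = 0 := by
    have hz : grossReturn (fun _ => 0) (z.1 : Fin n → ℝ) (z.2 : Fin n → ℝ) = 1 := by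
      have := sum_mul_pos z.1.2.1 z.2.2
      rw [grossReturn_eq]
      simp [weightFactor, this.ne']
    simp [reward, diversity, logReturn, hz]
  have := abs_reward_sub_le (η₀ := η₀) (η₁ := η₁) (ε₀ := B) (ε₁ := B) (l := l) (dl := dl)
    (l' := fun _ => 0) (dl' := fun _ => 0) hκ hη₁ h.le_tangent_zero h.le_tangent_one
    (fun x _ => by simpa using hκ1) (fun x _ => by simpa using hκ1)
    (fun x hx => by simpa using h.abs_le x hx) (fun x hx => by simpa using h.abs_deriv_le x hx) z
  rwa [h0, sub_zero] at this

theorem measurable_comp_of_mem_Icc {Ω : Type*} [MeasurableSpace Ω] {f : ℝ → ℝ}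
    (hf : Measurable ((Set.Icc (0 : ℝ) 1).indicator f)) {X : Ω → ℝ} (hX : Measurable X)
    (hmem : ∀ ω, X ω ∈ Set.Icc (0 : ℝ) 1) : Measurable fun ω => f (X ω) := by
  have : (fun ω => f (X ω)) = (Set.Icc (0 : ℝ) 1).indicator f ∘ X := by
    funext ω
    simp only [Function.comp_apply]
    rw [Set.indicator_of_mem (hmem ω)]
  rw [this]
  exact hf.comp hX

theorem measurable_reward {η₀ η₁ : ℝ} {l dl : ℝ → ℝ}
    (hl : Measurable ((Set.Icc (0 : ℝ) 1).indicator l))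
    (hdl : Measurable ((Set.Icc (0 : ℝ) 1).indicator dl)) :
    Measurable (reward (n := n) η₀ η₁ l dl) := by
  have hu : ∀ k, Measurable fun z : DataSpace n => (z.1 : Fin n → ℝ) k := fun k =>
    (measurable_pi_apply k).comp (measurable_subtype_coe.comp measurable_fst)
  have hr : ∀ k, Measurable fun z : DataSpace n => (z.2 : Fin n → ℝ) k := fun k =>
    (measurable_pi_apply k).comp (measurable_subtype_coe.comp measurable_snd)
  have hur : Measurable fun z : DataSpace n =>
      ∑ i, (z.1 : Fin n → ℝ) i * (z.2 : Fin n → ℝ) i :=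
    Finset.measurable_sum _ fun i _ => (hu i).mul (hr i)
  have hlu : ∀ k, Measurable fun z : DataSpace n => l ((z.1 : Fin n → ℝ) k) := fun k =>
    measurable_comp_of_mem_Icc hl (hu k) fun z => mem_Icc_of_mem_openSimplex z.1.2.1 k
  have hdu : ∀ k, Measurable fun z : DataSpace n => dl ((z.1 : Fin n → ℝ) k) := fun k =>
    measurable_comp_of_mem_Icc hdl (hu k) fun z => mem_Icc_of_mem_openSimplex z.1.2.1 k
  have hlv : ∀ k, Measurable fun z : DataSpace n =>
      l (aitchisonAdd (z.1 : Fin n → ℝ) (z.2 : Fin n → ℝ) k) := fun k =>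
    measurable_comp_of_mem_Icc hl (((hu k).mul (hr k)).div hur)
      fun z => aitchisonAdd_mem_Icc z.1.2.1 z.2.2 k
  unfold reward diversity logReturn grossReturn portfolio
  refine Measurable.add (Measurable.const_mul (Measurable.const_mul
    (Finset.measurable_sum _ fun k _ => (hlv k).sub (hlu k)) _) _) (Measurable.const_mul
    (Real.measurable_log.comp (Measurable.div (Finset.measurable_sum _ fun i _ => ?_) hur)) _)
  exact ((hu i).mul ((measurable_const.add ((hdu i).const_mul _)).sub
    ((Finset.measurable_sum _ fun j _ => (hu j).mul (hdu j)).const_mul _))).mul (hr i)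

theorem IsAdmissible.objectiveDefined {B κ η₀ η₁ : ℝ} {l dl : ℝ → ℝ} (h : IsAdmissible B κ l dl)
    (hκ : 0 < κ) (hη₁ : 0 ≤ η₁) (hl : Measurable ((Set.Icc (0 : ℝ) 1).indicator l))
    (hdl : Measurable ((Set.Icc (0 : ℝ) 1).indicator dl)) (γ : Measure (DataSpace n))
    [IsFiniteMeasure γ] : ObjectiveDefined η₀ η₁ γ l dl := by
  refine ⟨fun z => hκ.trans_le (le_grossReturn z.1.2.1 z.2.2 h.le_tangent_zero h.le_tangent_one),
    Integrable.of_bound (measurable_reward hl hdl).aestronglyMeasurable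
      (|η₀| * (2 * B) + η₁ * (2 * B / κ)) (Filter.Eventually.of_forall fun z => ?_)⟩
  rw [Real.norm_eq_abs]
  exact h.abs_reward_le hκ hη₁ z

theorem abs_objective_sub_le {κ ε₀ ε₁ η₀ η₁ : ℝ} {B B' : ℝ} {l dl l' dl' : ℝ → ℝ}
    (γ : Measure (DataSpace n)) [IsProbabilityMeasure γ] (hκ : 0 < κ) (hη₁ : 0 ≤ η₁)
    (h : IsAdmissible B κ l dl) (h' : IsAdmissible B' κ l' dl')
    (hi : ObjectiveDefined η₀ η₁ γ l dl) (hi' : ObjectiveDefined η₀ η₁ γ l' dl')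
    (hl : ∀ x ∈ Set.Icc (0 : ℝ) 1, |l x - l' x| ≤ ε₀)
    (hdl : ∀ x ∈ Set.Icc (0 : ℝ) 1, |dl x - dl' x| ≤ ε₁) :
    |objective η₀ η₁ γ l dl - objective η₀ η₁ γ l' dl'|
      ≤ |η₀| * (2 * ε₀) + η₁ * (2 * ε₁ / κ) := by
  unfold objective
  rw [← integral_sub hi.2 hi'.2, ← Real.norm_eq_abs]
  have := norm_integral_le_of_norm_le_const (μ := γ)
    (f := fun z => reward η₀ η₁ l dl z - reward η₀ η₁ l' dl' z)
    (C := |η₀| * (2 * ε₀) + η₁ * (2 * ε₁ / κ)) (Filter.Eventually.of_forall fun z => by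
      rw [Real.norm_eq_abs]
      exact abs_reward_sub_le hκ hη₁ h.le_tangent_zero h.le_tangent_one h'.le_tangent_zero
        h'.le_tangent_one hl hdl z)
  simpa using this

theorem IsAdmissible.objective_le {B κ η₀ η₁ : ℝ} {l dl : ℝ → ℝ}
    (γ : Measure (DataSpace n)) [IsProbabilityMeasure γ] (hκ : 0 < κ) (hη₁ : 0 ≤ η₁)
    (h : IsAdmissible B κ l dl) :
    objective η₀ η₁ γ l dl ≤ |η₀| * (2 * B) + η₁ * (2 * B / κ) := by
  have := norm_integral_le_of_norm_le_const (μ := γ) (f := reward η₀ η₁ l dl)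
    (C := |η₀| * (2 * B) + η₁ * (2 * B / κ)) (Filter.Eventually.of_forall fun z => by
      rw [Real.norm_eq_abs]
      exact h.abs_reward_le hκ hη₁ z)
  have h2 := (Real.le_norm_self _).trans this
  simpa [objective] using h2

/-! ### The class `𝓔_β` -/

section smoothClass

variable {β : ℝ} {l : ℝ → ℝ}

theorem hasDerivWithinAt_of_mem_smoothClass (hl : l ∈ smoothClass β) {x : ℝ}
    (hx : x ∈ Set.Icc (0 : ℝ) 1) : HasDerivWithinAt l (derivUnit l x) (Set.Icc 0 1) x :=
  ((hl.1.differentiableOn one_ne_zero) x hx).hasDerivWithinAt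

theorem continuousOn_derivUnit (hl : l ∈ smoothClass β) :
    ContinuousOn (derivUnit l) (Set.Icc 0 1) :=
  hl.1.continuousOn_derivWithin (uniqueDiffOn_Icc zero_lt_one) le_rfl

/-- The tangent inequality for the concave function `e^ℓ`, divided by `e^{ℓ(x)}`. -/
theorem exp_sub_le_of_mem_smoothClass (hl : l ∈ smoothClass β) {x y : ℝ}
    (hx : x ∈ Set.Icc (0 : ℝ) 1) (hy : y ∈ Set.Icc (0 : ℝ) 1) :
    Real.exp (l y - l x) ≤ 1 + derivUnit l x * (y - x) := by
  have hd := (hasDerivWithinAt_of_mem_smoothClass hl hx).exp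
  have key : Real.exp (l y) ≤
      Real.exp (l x) + Real.exp (l x) * derivUnit l x * (y - x) := by
    rcases lt_trichotomy x y with h | h | h
    · have := hl.2.1.slope_le_of_hasDerivWithinAt hx hy h hd
      rw [slope_def_field, div_le_iff₀ (sub_pos.mpr h)] at this
      linarith
    · simp [h]
    · have := hl.2.1.le_slope_of_hasDerivWithinAt hy hx h hd
      rw [slope_def_field, le_div_iff₀ (sub_pos.mpr h)] at this
      linarith
  rw [Real.exp_sub, div_le_iff₀ (Real.exp_pos _)]
  linarith

/-- Multiplying the tangent inequalities at two points gives `ℓ'(x) ℓ'(y) ≤ β`. -/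
theorem derivUnit_mul_le (hl : l ∈ smoothClass β) {x y : ℝ}
    (hx : x ∈ Set.Icc (0 : ℝ) 1) (hy : y ∈ Set.Icc (0 : ℝ) 1) (hxy : x ≠ y) :
    derivUnit l x * derivUnit l y ≤ β := by
  wlog h : x < y generalizing x y
  · rw [mul_comm]
    exact this hy hx hxy.symm (lt_of_le_of_ne (not_lt.mp h) hxy.symm)
  have h1 := exp_sub_le_of_mem_smoothClass hl hx hy
  have h2 := exp_sub_le_of_mem_smoothClass hl hy hx
  have hprod : (1 : ℝ) ≤ (1 + derivUnit l x * (y - x)) * (1 + derivUnit l y * (x - y)) := by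
    calc (1 : ℝ) = Real.exp (l y - l x) * Real.exp (l x - l y) := by
          rw [← Real.exp_add]
          simp
      _ ≤ _ := mul_le_mul h1 h2 (Real.exp_pos _).le ((Real.exp_pos _).le.trans h1)
  have hlip := (abs_le.mp (hl.2.2.2 x hx y hy)).2
  rw [abs_sub_comm, abs_of_pos (sub_pos.mpr h)] at hlip
  have hh := sub_pos.mpr h
  have e1 : derivUnit l x * derivUnit l y * (y - x) ≤ derivUnit l x - derivUnit l y := by
    refine le_of_mul_le_mul_right ?_ hh
    nlinarith
  exact le_of_mul_le_mul_right (e1.trans hlip) hh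

theorem abs_derivUnit_le (hl : l ∈ smoothClass β) (hβ : 0 < β) {x : ℝ}
    (hx : x ∈ Set.Icc (0 : ℝ) 1) : |derivUnit l x| ≤ Real.sqrt β := by
  refine Real.abs_le_sqrt (le_of_forall_pos_le_add fun ε hε => ?_)
  set a := derivUnit l x with ha
  obtain ⟨t, ht0, ht1, htε⟩ : ∃ t : ℝ, 0 < t ∧ t ≤ 1 / 2 ∧ |a| * (β * t) ≤ ε := by
    refine ⟨min (1 / 2) (ε / (|a| * β + 1)), by positivity, min_le_left _ _, ?_⟩
    have hle := min_le_right (1 / 2) (ε / (|a| * β + 1))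
    have hnn : 0 ≤ |a| * β := by positivity
    calc |a| * (β * min (1 / 2) (ε / (|a| * β + 1)))
        = (|a| * β) * min (1 / 2) (ε / (|a| * β + 1)) := by ring
      _ ≤ (|a| * β + 1) * (ε / (|a| * β + 1)) := by gcongr; linarith
      _ = ε := by field_simp
  obtain ⟨y, hy, hxy⟩ : ∃ y ∈ Set.Icc (0 : ℝ) 1, |x - y| = t := by
    rcases le_total x (1 / 2) with h | h
    · exact ⟨x + t, ⟨by linarith [hx.1], by linarith⟩, by
        rw [sub_add_cancel_left, abs_neg, abs_of_pos ht0]⟩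
    · exact ⟨x - t, ⟨by linarith, by linarith [hx.2]⟩, by
        rw [sub_sub_cancel, abs_of_pos ht0]⟩
  have hne : x ≠ y := by
    rintro rfl
    rw [sub_self, abs_zero] at hxy
    exact ht0.ne hxy
  have h1 := derivUnit_mul_le hl hx hy hne
  have h2 := hl.2.2.2 x hx y hy
  rw [hxy] at h2
  calc a ^ 2 = a * derivUnit l y + a * (a - derivUnit l y) := by ring
    _ ≤ β + |a| * |a - derivUnit l y| := by
        rw [← abs_mul]
        exact add_le_add h1 (le_abs_self _)
    _ ≤ β + |a| * (β * t) := by gcongr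
    _ ≤ β + ε := by linarith

theorem abs_sub_le_of_mem_smoothClass (hl : l ∈ smoothClass β) (hβ : 0 < β) {x y : ℝ}
    (hx : x ∈ Set.Icc (0 : ℝ) 1) (hy : y ∈ Set.Icc (0 : ℝ) 1) :
    |l y - l x| ≤ Real.sqrt β := by
  have := (convex_Icc (0 : ℝ) 1).norm_image_sub_le_of_norm_hasDerivWithin_le
    (fun z hz => hasDerivWithinAt_of_mem_smoothClass hl hz)
    (fun z hz => by rw [Real.norm_eq_abs]; exact abs_derivUnit_le hl hβ hz) hx hy
  rw [Real.norm_eq_abs, Real.norm_eq_abs] at this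
  have h1 : |y - x| ≤ 1 := by
    rw [abs_le]
    constructor <;> linarith [hx.1, hx.2, hy.1, hy.2]
  calc |l y - l x| ≤ Real.sqrt β * |y - x| := this
    _ ≤ Real.sqrt β * 1 := by gcongr
    _ = Real.sqrt β := mul_one _

theorem exp_neg_sqrt_le_tangent (hl : l ∈ smoothClass β) (hβ : 0 < β) {x y : ℝ}
    (hx : x ∈ Set.Icc (0 : ℝ) 1) (hy : y ∈ Set.Icc (0 : ℝ) 1) :
    Real.exp (-Real.sqrt β) ≤ 1 + derivUnit l x * (y - x) := by
  refine le_trans (Real.exp_le_exp.mpr ?_) (exp_sub_le_of_mem_smoothClass hl hx hy)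
  exact (abs_le.mp (abs_sub_le_of_mem_smoothClass hl hβ hx hy)).1

theorem isAdmissible_of_mem_smoothClass (hl : l ∈ smoothClass β) (hβ : 0 < β) :
    IsAdmissible (Real.sqrt β) (Real.exp (-Real.sqrt β)) l (derivUnit l) where
  abs_le x hx := by
    have := abs_sub_le_of_mem_smoothClass hl hβ (x := 1 / 2) (by norm_num) hx
    rwa [hl.2.2.1, sub_zero] at this
  abs_deriv_le x hx := abs_derivUnit_le hl hβ hx
  le_tangent_zero x hx := by
    have := exp_neg_sqrt_le_tangent hl hβ hx (y := 0) (by simp)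
    linarith
  le_tangent_one x hx := exp_neg_sqrt_le_tangent hl hβ hx (by simp)

theorem measurable_indicator_of_continuousOn {f : ℝ → ℝ} (hf : ContinuousOn f (Set.Icc 0 1)) :
    Measurable ((Set.Icc (0 : ℝ) 1).indicator f) := by
  classical
  rw [← Set.piecewise_eq_indicator]
  exact hf.measurable_piecewise continuousOn_const measurableSet_Icc

theorem objectiveDefined_of_mem_smoothClass (hl : l ∈ smoothClass β) (hβ : 0 < β)
    {η₀ η₁ : ℝ} (hη₁ : 0 ≤ η₁) (γ : Measure (DataSpace n)) [IsFiniteMeasure γ] :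
    ObjectiveDefined η₀ η₁ γ l (derivUnit l) :=
  (isAdmissible_of_mem_smoothClass hl hβ).objectiveDefined (Real.exp_pos _) hη₁
    (measurable_indicator_of_continuousOn hl.1.continuousOn)
    (measurable_indicator_of_continuousOn (continuousOn_derivUnit hl)) γ

theorem zero_mem_smoothClass (hβ : 0 < β) : (fun _ => (0 : ℝ)) ∈ smoothClass β := by
  have h : ∀ x, derivUnit (fun _ => (0 : ℝ)) x = 0 := fun x => by simp [derivUnit]
  refine ⟨contDiffOn_const, concaveOn_const _ (convex_Icc 0 1), rfl, fun x _ y _ => ?_⟩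
  rw [h, h]
  simp
  positivity

theorem isLUB_optimalValue (hβ : 0 < β) {η₀ η₁ : ℝ} (hη₁ : 0 ≤ η₁)
    (γ : Measure (DataSpace n)) [IsProbabilityMeasure γ] :
    IsLUB (continuousValues β η₀ η₁ γ) (optimalValue β η₀ η₁ γ) := by
  refine isLUB_csSup ⟨_, _, zero_mem_smoothClass hβ, rfl⟩ ⟨|η₀| * (2 * Real.sqrt β) +
    η₁ * (2 * Real.sqrt β / Real.exp (-Real.sqrt β)), ?_⟩
  rintro _ ⟨l, hl, rfl⟩
  exact (isAdmissible_of_mem_smoothClass hl hβ).objective_le γ (Real.exp_pos _) hη₁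

end smoothClass

/-! ### Nodal values of functions in `𝓔_β` -/

namespace MeshPartition

variable {m : ℕ} (P : MeshPartition m)

theorem width_pos (i : Fin (m + 1)) : 0 < P.width i :=
  sub_pos.mpr (P.strictMono_node Fin.castSucc_lt_succ)

theorem width_le_mesh (i : Fin (m + 1)) : P.width i ≤ P.mesh :=
  le_ciSup (Set.finite_range P.width).bddAbove i

theorem minMesh_le_width (i : Fin (m + 1)) : P.minMesh ≤ P.width i :=
  ciInf_le (Set.finite_range P.width).bddBelow i

theorem minMesh_pos : 0 < P.minMesh := by
  obtain ⟨i, hi⟩ := Set.Nonempty.csInf_mem (Set.range_nonempty P.width) (Set.finite_range P.width)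
  unfold minMesh iInf
  rw [← hi]
  exact P.width_pos i

theorem minMesh_le_mesh : P.minMesh ≤ P.mesh := (P.minMesh_le_width 0).trans (P.width_le_mesh 0)

theorem node_mem_Icc (i : Fin (m + 2)) : P.node i ∈ Set.Icc (0 : ℝ) 1 := by
  constructor
  · rw [← P.node_zero]
    exact P.strictMono_node.monotone (Fin.zero_le _)
  · rw [← P.node_last]
    exact P.strictMono_node.monotone (Fin.le_last _)

theorem cell_subset (i : Fin (m + 1)) : P.cell i ⊆ Set.Icc 0 1 :=
  Set.Icc_subset_Icc (P.node_mem_Icc _).1 (P.node_mem_Icc _).2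

theorem slope_mul_width (v : Fin (m + 2) → ℝ) (i : Fin (m + 1)) :
    P.slope v i * P.width i = v i.succ - v i.castSucc :=
  div_mul_cancel₀ _ (P.width_pos i).ne'

theorem interp_node (v : Fin (m + 2) → ℝ) (i : Fin (m + 2)) : P.interp v (P.node i) = v i := by
  induction i using Fin.lastCases with
  | last =>
    have h := P.interp_eq_of_mem v (x := P.node (Fin.last (m + 1))) (i := Fin.last m)
      ⟨P.strictMono_node.monotone (Fin.le_last _), le_rfl⟩
    rw [h]
    have := P.slope_mul_width v (Fin.last m)
    unfold width at this
    rw [Fin.succ_last] at this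
    rw [this]
    ring
  | cast j =>
    rw [P.interp_eq_of_mem v (i := j) ⟨le_rfl, (P.strictMono_node Fin.castSucc_lt_succ).le⟩]
    ring

section restrict

variable {β : ℝ} {l : ℝ → ℝ}

theorem exists_slope_eq_derivUnit (hl : l ∈ smoothClass β) (i : Fin (m + 1)) :
    ∃ x ∈ P.cell i, P.slope (fun j => l (P.node j)) i = derivUnit l x := by
  have hlt : P.node i.castSucc < P.node i.succ := P.strictMono_node Fin.castSucc_lt_succ
  obtain ⟨c, hc, h⟩ := exists_hasDerivAt_eq_slope l (derivUnit l) hlt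
    (hl.1.continuousOn.mono (P.cell_subset i)) (fun x hx =>
      (hasDerivWithinAt_of_mem_smoothClass hl (P.cell_subset i ⟨hx.1.le, hx.2.le⟩)).hasDerivAt
        (Icc_mem_nhds ((P.node_mem_Icc _).1.trans_lt hx.1) (hx.2.trans_le (P.node_mem_Icc _).2)))
  exact ⟨c, ⟨hc.1.le, hc.2.le⟩, h.symm⟩

/-- Both difference quotients are averages of `ℓ'` over the respective cell. Comparing `ℓ'` at the
points that divide the two cells in the same ratio `t`, whose distance averages to half the
total length, gives the sharp constant `β / 2`. -/
theorem neg_le_slope_sub_slope (hl : l ∈ smoothClass β) (i : Fin m) :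
    -(β / 2 * (P.node i.succ.succ - P.node i.castSucc.castSucc)) ≤
      P.slope (fun j => l (P.node j)) i.succ - P.slope (fun j => l (P.node j)) i.castSucc := by
  set a := P.node i.castSucc.castSucc with ha
  set b := P.node i.succ.castSucc with hb
  set c := P.node i.succ.succ with hc
  have hab : a < b := P.strictMono_node Fin.castSucc_lt_succ
  have hbc : b < c := P.strictMono_node Fin.castSucc_lt_succ
  have ha0 : 0 ≤ a := (P.node_mem_Icc _).1
  have hc1 : c ≤ 1 := (P.node_mem_Icc _).2
  let ψ : ℝ → ℝ := fun t => l (b + t * (c - b)) / (c - b) - l (a + t * (b - a)) / (b - a)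
    + β * ((b - a) * t + t ^ 2 / 2 * ((c - b) - (b - a)))
  have hmem1 : ∀ t ∈ Set.Icc (0 : ℝ) 1, b + t * (c - b) ∈ Set.Icc b c := fun t ht =>
    ⟨by nlinarith [ht.1], by nlinarith [ht.2]⟩
  have hmem0 : ∀ t ∈ Set.Icc (0 : ℝ) 1, a + t * (b - a) ∈ Set.Icc a b := fun t ht =>
    ⟨by nlinarith [ht.1], by nlinarith [ht.2]⟩
  have hbc01 : Set.Icc b c ⊆ Set.Icc (0 : ℝ) 1 := Set.Icc_subset_Icc (by linarith) hc1
  have hab01 : Set.Icc a b ⊆ Set.Icc (0 : ℝ) 1 := Set.Icc_subset_Icc ha0 (by linarith)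
  have hderiv : ∀ t ∈ Set.Icc (0 : ℝ) 1, HasDerivWithinAt ψ
      (derivUnit l (b + t * (c - b)) - derivUnit l (a + t * (b - a))
        + β * ((b - a) + t * ((c - b) - (b - a)))) (Set.Icc 0 1) t := by
    intro t ht
    have hd : ∀ p q : ℝ, p < q → Set.Icc p q ⊆ Set.Icc (0 : ℝ) 1 →
        (∀ t ∈ Set.Icc (0 : ℝ) 1, p + t * (q - p) ∈ Set.Icc p q) →
        HasDerivWithinAt (fun t => l (p + t * (q - p)) / (q - p)) (derivUnit l (p + t * (q - p)))
          (Set.Icc 0 1) t := by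
      intro p q hpq hsub hmem
      have h1 : HasDerivWithinAt (fun t : ℝ => p + t * (q - p)) (q - p) (Set.Icc 0 1) t := by
        simpa using (((hasDerivAt_id t).mul_const (q - p)).const_add p).hasDerivWithinAt
      have h2 := (hasDerivWithinAt_of_mem_smoothClass hl (hsub (hmem t ht))).comp t h1
        (fun s hs => hsub (hmem s hs))
      have h3 := h2.div_const (q - p)
      rwa [mul_div_cancel_right₀ _ (sub_pos.mpr hpq).ne'] at h3
    have hq : HasDerivAt (fun t : ℝ => β * ((b - a) * t + t ^ 2 / 2 * ((c - b) - (b - a))))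
        (β * ((b - a) + t * ((c - b) - (b - a)))) t := by
      have h1 := ((hasDerivAt_id t).const_mul (b - a))
      have h2 := (((hasDerivAt_pow 2 t).div_const 2).mul_const ((c - b) - (b - a)))
      have h3 := (h1.add h2).const_mul β
      exact h3.congr_deriv (by push_cast; ring)
    exact ((hd b c hbc hbc01 hmem1).sub (hd a b hab hab01 hmem0)).add hq.hasDerivWithinAt
  have hmono : MonotoneOn ψ (Set.Icc 0 1) := by
    refine monotoneOn_of_hasDerivWithinAt_nonneg (convex_Icc 0 1)
      (fun t ht => (hderiv t ht).continuousWithinAt)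
      (fun t ht => (hderiv t (interior_subset ht)).mono interior_subset) fun t ht => ?_
    have ht := interior_subset ht
    have hlip := (abs_le.mp (hl.2.2.2 _ (hbc01 (hmem1 t ht)) _ (hab01 (hmem0 t ht)))).1
    rw [abs_of_nonneg (by linarith [(hmem1 t ht).1, (hmem0 t ht).2])] at hlip
    linarith
  have h01 := hmono (by simp : (0 : ℝ) ∈ Set.Icc (0 : ℝ) 1) (by simp : (1 : ℝ) ∈ Set.Icc (0 : ℝ) 1)
    zero_le_one
  have e1 : P.slope (fun j => l (P.node j)) i.succ = (l c - l b) / (c - b) := rfl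
  have e0 : P.slope (fun j => l (P.node j)) i.castSucc = (l b - l a) / (b - a) := rfl
  rw [e1, e0, sub_div, sub_div]
  simp only [ψ] at h01
  norm_num at h01
  linarith

/-- The nodal values of a function of the class `𝓔_β` satisfy all discrete constraints exactly. -/
theorem feasible_of_mem_smoothClass (hl : l ∈ smoothClass β) (hβ : 0 < β) :
    P.Feasible β fun j => l (P.node j) := by
  have hslope : ∀ i, P.slope (fun j => l (P.node j)) i ^ 2 - β ≤ 0 := by
    intro i
    obtain ⟨x, hx, h⟩ := P.exists_slope_eq_derivUnit hl i
    have := abs_derivUnit_le hl hβ (P.cell_subset i hx)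
    rw [h, ← sq_abs, sub_nonpos]
    calc |derivUnit l x| ^ 2 ≤ Real.sqrt β ^ 2 := by gcongr
      _ = β := Real.sq_sqrt hβ.le
  refine ⟨fun i => ?_, fun i => ?_, hslope 0, hslope _, ?_⟩
  · have hab : P.node i.castSucc.castSucc < P.node i.succ.castSucc :=
      P.strictMono_node Fin.castSucc_lt_succ
    have hbc : P.node i.succ.castSucc < P.node i.succ.succ :=
      P.strictMono_node Fin.castSucc_lt_succ
    set a := P.node i.castSucc.castSucc
    set b := P.node i.succ.castSucc
    set c := P.node i.succ.succ
    have hac : 0 < c - a := by linarith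
    have hw0 : 0 < (b - a) / (c - a) := div_pos (by linarith) hac
    have hw1 : 0 < 1 - (b - a) / (c - a) := by
      rw [sub_pos, div_lt_one hac]
      linarith
    have hconc := hl.2.1.2 (P.node_mem_Icc i.succ.succ) (P.node_mem_Icc i.castSucc.castSucc)
      hw0.le hw1.le (by ring)
    have hb : (b - a) / (c - a) * c + (1 - (b - a) / (c - a)) * a = b := by
      field_simp
      ring
    simp only [smul_eq_mul] at hconc
    change _ ≤ Real.exp (l ((b - a) / (c - a) * c + (1 - (b - a) / (c - a)) * a)) at hconc
    rw [hb] at hconc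
    have hpos : 0 < (b - a) / (c - a) * Real.exp (l c)
        + (1 - (b - a) / (c - a)) * Real.exp (l a) := by positivity
    have := (Real.log_le_iff_le_exp hpos).mpr hconc
    linarith
  · have := P.neg_le_slope_sub_slope hl i
    linarith
  · obtain ⟨i, hi⟩ := P.half_mem
    rw [← hi, interp_node, hi, hl.2.2.1]

theorem abs_derivUnit_sub_slope_le (hl : l ∈ smoothClass β) (hβ : 0 < β) {i : Fin (m + 1)} {x : ℝ}
    (hx : x ∈ P.cell i) :
    |derivUnit l x - P.slope (fun j => l (P.node j)) i| ≤ β * P.mesh := by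
  obtain ⟨y, hy, h⟩ := P.exists_slope_eq_derivUnit hl i
  rw [h]
  refine (hl.2.2.2 x (P.cell_subset i hx) y (P.cell_subset i hy)).trans ?_
  gcongr
  have hw := P.width_le_mesh i
  unfold width at hw
  rw [abs_le]
  constructor <;> linarith [hx.1, hx.2, hy.1, hy.2]

end restrict

/-! ### Comparing functions cell by cell -/

theorem monotoneOn_of_pieces {k : ℕ} {τ : Fin (k + 1) → ℝ} (hτ : Monotone τ) {f : ℝ → ℝ}
    (h : ∀ i : Fin k, MonotoneOn f (Set.Icc (τ i.castSucc) (τ i.succ))) :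
    MonotoneOn f (Set.Icc (τ 0) (τ (Fin.last k))) := by
  suffices ∀ j, MonotoneOn f (Set.Icc (τ 0) (τ j)) from this _
  intro j
  induction j using Fin.induction with
  | zero => simp
  | succ i ih =>
    have h0 := hτ (Fin.zero_le i.castSucc)
    have h1 : τ i.castSucc ≤ τ i.succ := hτ Fin.castSucc_lt_succ.le
    have := ih.union_right (h i) (isGreatest_Icc h0) (isLeast_Icc h1)
    rwa [Set.Icc_union_Icc_eq_Icc h0 h1] at this

/-- If `ℓ(1/2) = 0 = v̂(1/2)` and the derivatives differ by at most `D`, then so do the functions: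
`ℓ - v̂ + D x` and `v̂ - ℓ + D x` increase on every cell. -/
theorem abs_sub_interp_le {D : ℝ} {l dl : ℝ → ℝ} {v : Fin (m + 2) → ℝ}
    (hl : ∀ x ∈ Set.Icc (0 : ℝ) 1, HasDerivWithinAt l (dl x) (Set.Icc 0 1) x)
    (hl0 : l (1 / 2) = 0) (hv0 : P.interp v (1 / 2) = 0)
    (hD : ∀ i, ∀ x ∈ P.cell i, |dl x - P.slope v i| ≤ D) {x : ℝ} (hx : x ∈ Set.Icc (0 : ℝ) 1) :
    |l x - P.interp v x| ≤ D := by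
  have hderiv : ∀ i, ∀ x ∈ P.cell i,
      HasDerivWithinAt (fun x => l x - P.interp v x) (dl x - P.slope v i) (P.cell i) x := by
    intro i x hx
    refine ((hl x (P.cell_subset i hx)).mono (P.cell_subset i)).sub ?_
    have h1 : HasDerivAt
        (fun x => v i.castSucc + P.slope v i * (x - P.node i.castSucc)) (P.slope v i) x := by
      simpa using (((hasDerivAt_id x).sub_const (P.node i.castSucc)).const_mul
        (P.slope v i)).const_add (v i.castSucc)
    exact h1.hasDerivWithinAt.congr (fun y hy => P.interp_eq_of_mem v hy) (P.interp_eq_of_mem v hx)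
  have hmono : ∀ s : ℝ, |s| = 1 →
      MonotoneOn (fun x => s * (l x - P.interp v x) + D * x) (Set.Icc 0 1) := by
    intro s hs
    have := monotoneOn_of_pieces P.strictMono_node.monotone
      (f := fun x => s * (l x - P.interp v x) + D * x) fun i => ?_
    · rwa [P.node_zero, P.node_last] at this
    have hd : ∀ x ∈ P.cell i, HasDerivWithinAt (fun x => s * (l x - P.interp v x) + D * x)
        (s * (dl x - P.slope v i) + D) (P.cell i) x := by
      intro x hx
      have h1 : HasDerivAt (fun x => D * x) D x := by
        simpa using (hasDerivAt_id x).const_mul D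
      exact ((hderiv i x hx).const_mul s).add h1.hasDerivWithinAt
    refine monotoneOn_of_hasDerivWithinAt_nonneg (convex_Icc _ _)
      (fun x hx => (hd x hx).continuousWithinAt)
      (fun x hx => (hd x (interior_subset hx)).mono interior_subset) fun x hx => ?_
    have h2 : |s * (dl x - P.slope v i)| ≤ D := by
      rw [abs_mul, hs, one_mul]
      exact hD i x (interior_subset hx)
    linarith [(abs_le.mp h2).1]
  have hD0 : 0 ≤ D := (abs_nonneg _).trans (hD 0 (P.node 0)
    ⟨le_rfl, P.strictMono_node.monotone (Fin.zero_le _)⟩)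
  have hp := hmono 1 (by simp)
  have hn := hmono (-1) (by simp)
  have hhalf : (1 / 2 : ℝ) ∈ Set.Icc (0 : ℝ) 1 := by norm_num
  rcases le_total x (1 / 2) with h | h
  · have h1 := hp hx hhalf h
    have h2 := hn hx hhalf h
    simp only [hl0, hv0] at h1 h2
    rw [abs_le]
    constructor <;> nlinarith [hx.1]
  · have h1 := hp hhalf hx h
    have h2 := hn hhalf hx h
    simp only [hl0, hv0] at h1 h2
    rw [abs_le]
    constructor <;> nlinarith [hx.2]

end MeshPartition

/-! ### Discrete exponential concavity -/

theorem le_exp_of_abs_le_one {t : ℝ} (ht : |t| ≤ 1) :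
    1 + t + t ^ 2 / 2 - |t| ^ 3 ≤ Real.exp t := by
  have h := Real.exp_bound ht (n := 3) (by norm_num)
  simp only [Finset.sum_range_succ, Finset.sum_range_zero] at h
  norm_num [Nat.factorial] at h
  have h1 := (abs_le.mp h).1
  have h2 : 0 ≤ |t| ^ 3 := by positivity
  linarith

namespace MeshPartition

variable {m : ℕ} (P : MeshPartition m) {β : ℝ} {v : Fin (m + 2) → ℝ}

/-- The discrete exponential concavity constraint at an interior node, with the exponentials
expressed through the two adjacent slopes. -/
theorem Feasible.width_mul_exp_le (hv : P.Feasible β v) (i : Fin m) :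
    P.width i.castSucc * (Real.exp (P.slope v i.succ * P.width i.succ) - 1) ≤
      P.width i.succ * (1 - Real.exp (-(P.slope v i.castSucc * P.width i.castSucc))) := by
  have h := hv.1 i
  have hwidth : P.width i.castSucc = P.node i.succ.castSucc - P.node i.castSucc.castSucc := rfl
  have hwidth' : P.width i.succ = P.node i.succ.succ - P.node i.succ.castSucc := rfl
  have hp := P.width_pos i.castSucc
  have hp' := P.width_pos i.succ
  rw [slope_mul_width, slope_mul_width]
  rw [show P.node i.succ.castSucc - P.node i.castSucc.castSucc = P.width i.castSucc from rfl,
    show P.node i.succ.succ - P.node i.castSucc.castSucc =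
      P.width i.castSucc + P.width i.succ by rw [hwidth, hwidth']; ring] at h
  rw [show i.castSucc.succ = i.succ.castSucc from rfl]
  set a := P.width i.castSucc
  set b := P.width i.succ
  have hab : 0 < a + b := by linarith
  have hone : 1 - a / (a + b) = b / (a + b) := by
    field_simp
    ring
  rw [hone] at h
  have hpos : 0 < a / (a + b) * Real.exp (v i.succ.succ)
      + b / (a + b) * Real.exp (v i.castSucc.castSucc) := by positivity
  have h2 := (Real.log_le_iff_le_exp hpos).mp (by linarith :
    Real.log _ ≤ v i.succ.castSucc)
  have h3 : a * Real.exp (v i.succ.succ) + b * Real.exp (v i.castSucc.castSucc) ≤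
      (a + b) * Real.exp (v i.succ.castSucc) := by
    have := mul_le_mul_of_nonneg_left h2 hab.le
    calc _ = (a + b) * (a / (a + b) * Real.exp (v i.succ.succ)
      + b / (a + b) * Real.exp (v i.castSucc.castSucc)) := by field_simp
      _ ≤ _ := this
  rw [neg_sub, Real.exp_sub, Real.exp_sub]
  have he := Real.exp_pos (v i.succ.castSucc)
  have h4 : a * (Real.exp (v i.succ.succ) / Real.exp (v i.succ.castSucc)) +
      b * (Real.exp (v i.castSucc.castSucc) / Real.exp (v i.succ.castSucc)) ≤ a + b := by
    rw [← mul_div_assoc, ← mul_div_assoc, ← add_div, div_le_iff₀ he]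
    exact h3
  linarith

theorem Feasible.slope_succ_le (hv : P.Feasible β v) (i : Fin m) :
    P.slope v i.succ ≤ P.slope v i.castSucc := by
  have h := hv.width_mul_exp_le P i
  have hp := P.width_pos i.castSucc
  have hp' := P.width_pos i.succ
  have h1 := Real.add_one_le_exp (P.slope v i.succ * P.width i.succ)
  have h2 := Real.add_one_le_exp (-(P.slope v i.castSucc * P.width i.castSucc))
  have h3 := mul_le_mul_of_nonneg_left h1 hp.le
  have h4 := mul_le_mul_of_nonneg_left h2 hp'.le
  refine le_of_mul_le_mul_left ?_ (mul_pos hp hp')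
  linarith

theorem Feasible.antitone_slope (hv : P.Feasible β v) : Antitone (P.slope v) :=
  Fin.antitone_iff_succ_le.mpr hv.slope_succ_le

theorem Feasible.abs_slope_le (hv : P.Feasible β v) (i : Fin (m + 1)) :
    |P.slope v i| ≤ Real.sqrt β := by
  have h0 := Real.abs_le_sqrt (sub_nonpos.mp hv.2.2.1)
  have h1 := Real.abs_le_sqrt (sub_nonpos.mp hv.2.2.2.1)
  have ha := hv.antitone_slope
  exact abs_le.mpr ⟨(abs_le.mp h1).1.trans (ha (Fin.le_last i)),
    (ha (Fin.zero_le i)).trans (abs_le.mp h0).2⟩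

/-- The second-order form of discrete exponential concavity, a discrete version of the Riccati
inequality `ℓ'' + ℓ'² ≤ 0`. -/
theorem Feasible.slope_sub_slope_le (hv : P.Feasible β v)
    (hmesh : Real.sqrt β * P.mesh ≤ 1) (i : Fin m) :
    P.slope v i.succ - P.slope v i.castSucc ≤
      -(P.slope v i.succ ^ 2 * P.width i.succ + P.slope v i.castSucc ^ 2 * P.width i.castSucc) / 2
        + 2 * Real.sqrt β ^ 3 * P.mesh ^ 2 := by
  have h := hv.width_mul_exp_le P i
  have hp := P.width_pos i.castSucc
  have hp' := P.width_pos i.succ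
  have hδ := P.width_le_mesh i.castSucc
  have hδ' := P.width_le_mesh i.succ
  have hs := hv.abs_slope_le P i.castSucc
  have hs' := hv.abs_slope_le P i.succ
  set a := P.width i.castSucc
  set b := P.width i.succ
  set s := P.slope v i.castSucc
  set s' := P.slope v i.succ
  set B := Real.sqrt β
  set δ := P.mesh
  have hB : 0 ≤ B := Real.sqrt_nonneg β
  have bound : ∀ r w : ℝ, |r| ≤ B → 0 < w → w ≤ δ → |r * w| ≤ B * δ := by
    intro r w hr hw hwδ
    rw [abs_mul, abs_of_pos hw]
    gcongr
  have cube : ∀ r w : ℝ, |r| ≤ B → 0 < w → w ≤ δ → |r * w| ^ 3 ≤ w * (B ^ 3 * δ ^ 2) := by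
    intro r w hr hw hwδ
    rw [abs_mul, abs_of_pos hw]
    calc (|r| * w) ^ 3 = w * (|r| ^ 3 * w ^ 2) := by ring
      _ ≤ w * (B ^ 3 * δ ^ 2) := by gcongr
  have e1 := le_exp_of_abs_le_one ((bound s' b hs' hp' hδ').trans hmesh)
  have e2 := le_exp_of_abs_le_one (t := -(s * a)) (by
    rw [abs_neg]
    exact (bound s a hs hp hδ).trans hmesh)
  rw [abs_neg] at e2
  have c1 := cube s' b hs' hp' hδ'
  have c2 := cube s a hs hp hδ
  have f1 : a * (s' * b + (s' * b) ^ 2 / 2 - b * (B ^ 3 * δ ^ 2)) ≤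
      a * (Real.exp (s' * b) - 1) := mul_le_mul_of_nonneg_left (by linarith) hp.le
  have f2 : b * (1 - Real.exp (-(s * a))) ≤
      b * (s * a - (s * a) ^ 2 / 2 + a * (B ^ 3 * δ ^ 2)) :=
    mul_le_mul_of_nonneg_left (by linarith) hp'.le
  refine le_of_mul_le_mul_left ?_ (mul_pos hp hp')
  linarith [f1.trans (h.trans f2)]

/-! ### Interpolating the slopes at the midpoints of the cells -/

theorem exists_eq_on_pieces {k : ℕ} {τ : Fin (k + 1) → ℝ} (hτ : StrictMono τ)
    (φ : Fin k → ℝ → ℝ)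
    (hφ : ∀ i j : Fin k, i.succ = j.castSucc → φ i (τ i.succ) = φ j (τ i.succ)) :
    ∃ g : ℝ → ℝ, ∀ i, ∀ x ∈ Set.Icc (τ i.castSucc) (τ i.succ), g x = φ i x := by
  suffices ∀ j : Fin (k + 1), ∃ g : ℝ → ℝ, ∀ i : Fin k, i.castSucc < j →
      ∀ x ∈ Set.Icc (τ i.castSucc) (τ i.succ), g x = φ i x by
    obtain ⟨g, hg⟩ := this (Fin.last k)
    exact ⟨g, fun i => hg i (Fin.castSucc_lt_last i)⟩
  intro j
  induction j using Fin.induction with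
  | zero => exact ⟨0, fun i hi => absurd hi (Fin.not_lt_zero _)⟩
  | succ j ih =>
    obtain ⟨g, hg⟩ := ih
    refine ⟨fun x => if x < τ j.castSucc then g x else φ j x, fun i hi x hx => ?_⟩
    dsimp only
    -- The test is strict, so at the junction the new piece is used; `hφ` reconciles it with the old.
    split_ifs with hlt
    · refine hg i (hτ.lt_iff_lt.mp (hx.1.trans_lt hlt)) x hx
    · rcases (show i ≤ j from Nat.lt_succ_iff.mp hi).eq_or_lt
        with rfl | hij
      · rfl
      · have hle : i.succ ≤ j.castSucc := hij
        have hx' : x = τ i.succ :=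
          le_antisymm hx.2 ((hτ.monotone hle).trans (not_lt.mp hlt))
        have heq : i.succ = j.castSucc :=
          le_antisymm hle (hτ.le_iff_le.mp ((not_lt.mp hlt).trans hx.2))
        rw [hx', hφ i j heq]

/-- The midpoint of the `i`-th cell. -/
noncomputable def midpoint (i : Fin (m + 1)) : ℝ := (P.node i.castSucc + P.node i.succ) / 2

theorem num_interior_pos {m : ℕ} (P : MeshPartition m) : 0 < m := by
  rcases Nat.eq_zero_or_pos m with rfl | h
  · obtain ⟨i, hi⟩ := P.half_mem
    have h0 := P.node_zero
    have h1 := P.node_last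
    rcases (by omega : i.val = 0 ∨ i.val = 1) with h | h
    · rw [show i = 0 from Fin.ext h, h0] at hi
      norm_num at hi
    · rw [show i = Fin.last (0 + 1) from Fin.ext h, h1] at hi
      norm_num at hi
  · exact h

theorem midpoint_succ_sub (i : Fin m) : P.midpoint i.succ - P.midpoint i.castSucc =
    (P.width i.castSucc + P.width i.succ) / 2 := by
  unfold midpoint width
  rw [show i.castSucc.succ = i.succ.castSucc from rfl]
  ring

theorem midpoint_mem_Ioo (i : Fin (m + 1)) : P.midpoint i ∈ Set.Ioo (0 : ℝ) 1 := by
  have h := P.width_pos i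
  have h0 := (P.node_mem_Icc i.castSucc).1
  have h1 := (P.node_mem_Icc i.succ).2
  unfold width at h
  unfold midpoint
  constructor <;> linarith

/-- The breakpoints of the interpolant: the midpoints, except that the first and the last one are
moved to the endpoints of `[0, 1]`, so that the two extreme affine pieces extend to the
boundary. -/
noncomputable def breakpoint (j : Fin (m + 1)) : ℝ :=
  if j = 0 then 0 else if j = Fin.last m then 1 else P.midpoint j

theorem breakpoint_zero : P.breakpoint 0 = 0 := by simp [breakpoint]

theorem breakpoint_last : P.breakpoint (Fin.last m) = 1 := by
  have h : Fin.last m ≠ 0 := fun h => P.num_interior_pos.ne' (congrArg Fin.val h)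
  simp [breakpoint, h]

theorem breakpoint_castSucc_le (i : Fin m) : P.breakpoint i.castSucc ≤ P.midpoint i.castSucc := by
  unfold breakpoint
  split_ifs with h h'
  · exact (P.midpoint_mem_Ioo _).1.le
  · exact absurd h' (Fin.castSucc_lt_last i).ne
  · exact le_rfl

theorem midpoint_succ_le_breakpoint (i : Fin m) : P.midpoint i.succ ≤ P.breakpoint i.succ := by
  unfold breakpoint
  rw [if_neg (Fin.succ_ne_zero i)]
  split_ifs with h
  · exact (P.midpoint_mem_Ioo _).2.le
  · exact le_rfl

theorem le_breakpoint_castSucc (i : Fin m) :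
    P.midpoint i.castSucc - P.mesh ≤ P.breakpoint i.castSucc := by
  have hw := P.width_le_mesh i.castSucc
  have hp := P.width_pos i.castSucc
  unfold breakpoint
  split_ifs with h h'
  · have h0 : P.node i.castSucc.castSucc = 0 := by rw [h]; exact P.node_zero
    unfold midpoint
    unfold width at hw hp
    linarith
  · exact absurd h' (Fin.castSucc_lt_last i).ne
  · linarith

theorem breakpoint_succ_le (i : Fin m) :
    P.breakpoint i.succ ≤ P.midpoint i.succ + P.mesh := by
  have hw := P.width_le_mesh i.succ
  have hp := P.width_pos i.succ
  unfold breakpoint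
  rw [if_neg (Fin.succ_ne_zero i)]
  split_ifs with h
  · have h0 : P.node i.succ.succ = 1 := by rw [h]; exact P.node_last
    unfold midpoint
    unfold width at hw hp
    linarith
  · linarith

theorem strictMono_breakpoint : StrictMono P.breakpoint := by
  refine Fin.strictMono_iff_lt_succ.mpr fun i => ?_
  have h := P.midpoint_succ_sub i
  linarith [P.width_pos i.castSucc, P.width_pos i.succ, P.breakpoint_castSucc_le i,
    P.midpoint_succ_le_breakpoint i]

/-- The slope of the line through the points `(midpoint, slope v)` of two consecutive cells. -/
noncomputable def secondSlope (v : Fin (m + 2) → ℝ) (i : Fin m) : ℝ :=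
  (P.slope v i.succ - P.slope v i.castSucc) / (P.midpoint i.succ - P.midpoint i.castSucc)

theorem midpoint_lt (i : Fin m) : 0 < P.midpoint i.succ - P.midpoint i.castSucc := by
  rw [midpoint_succ_sub]
  linarith [P.width_pos i.castSucc, P.width_pos i.succ]

theorem Feasible.neg_le_secondSlope (hv : P.Feasible β v) (i : Fin m) :
    -β ≤ P.secondSlope v i := by
  unfold secondSlope
  rw [le_div_iff₀ (P.midpoint_lt i), midpoint_succ_sub]
  have h := hv.2.1 i
  unfold width
  rw [show i.castSucc.succ = i.succ.castSucc from rfl]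
  linarith

theorem Feasible.secondSlope_nonpos (hv : P.Feasible β v) (i : Fin m) :
    P.secondSlope v i ≤ 0 :=
  div_nonpos_of_nonpos_of_nonneg (sub_nonpos.mpr (hv.slope_succ_le P i)) (P.midpoint_lt i).le

/-- On `[0, 1]`, `g` is the piecewise affine function that takes the value `slope v i` at the
midpoint of the `i`-th cell; its extreme pieces extend to the endpoints. -/
def IsSlopeInterpolant (v : Fin (m + 2) → ℝ) (g : ℝ → ℝ) : Prop :=
  ∀ i : Fin m, ∀ x ∈ Set.Icc (P.breakpoint i.castSucc) (P.breakpoint i.succ),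
    g x = P.slope v i.castSucc + P.secondSlope v i * (x - P.midpoint i.castSucc)

theorem exists_isSlopeInterpolant (v : Fin (m + 2) → ℝ) : ∃ g, P.IsSlopeInterpolant v g := by
  refine exists_eq_on_pieces P.strictMono_breakpoint
    (fun i x => P.slope v i.castSucc + P.secondSlope v i * (x - P.midpoint i.castSucc)) ?_
  intro i j hij
  have hb : P.breakpoint i.succ = P.midpoint i.succ := by
    unfold breakpoint
    rw [if_neg (Fin.succ_ne_zero i), if_neg]
    rw [hij]
    exact (Fin.castSucc_lt_last j).ne
  rw [hb, ← hij, sub_self, mul_zero, add_zero, secondSlope, div_mul_cancel₀ _ (P.midpoint_lt i).ne']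
  ring

section interpolant

variable {g : ℝ → ℝ}

theorem IsSlopeInterpolant.apply_midpoint (hg : P.IsSlopeInterpolant v g)
    (j : Fin (m + 1)) : g (P.midpoint j) = P.slope v j := by
  have hm := P.num_interior_pos
  induction j using Fin.lastCases with
  | last =>
    obtain ⟨k, rfl⟩ := Nat.exists_eq_succ_of_ne_zero hm.ne'
    have hlt := P.midpoint_lt (Fin.last k)
    have := hg (Fin.last k) (P.midpoint (Fin.last k).succ)
      ⟨by linarith [P.breakpoint_castSucc_le (Fin.last k)], P.midpoint_succ_le_breakpoint _⟩
    rw [secondSlope, div_mul_cancel₀ _ hlt.ne'] at this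
    rw [Fin.succ_last] at this
    rw [this]
    ring
  | cast i =>
    have hlt := P.midpoint_lt i
    rw [hg i _ ⟨P.breakpoint_castSucc_le i, by linarith [P.midpoint_succ_le_breakpoint i]⟩]
    ring

theorem IsSlopeInterpolant.abs_sub_le (hg : P.IsSlopeInterpolant v g) (hv : P.Feasible β v)
    {x y : ℝ} (hx : x ∈ Set.Icc (0 : ℝ) 1) (hy : y ∈ Set.Icc (0 : ℝ) 1) :
    |g x - g y| ≤ β * |x - y| := by
  have hanti : MonotoneOn (fun x => -g x) (Set.Icc 0 1) := by
    have := monotoneOn_of_pieces P.strictMono_breakpoint.monotone (f := fun x => -g x)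
      fun i x hx y hy hxy => ?_
    · rwa [breakpoint_zero, breakpoint_last] at this
    · simp only [hg i x hx, hg i y hy]
      nlinarith [hv.secondSlope_nonpos P i]
  have hmono : MonotoneOn (fun x => g x + β * x) (Set.Icc 0 1) := by
    have := monotoneOn_of_pieces P.strictMono_breakpoint.monotone (f := fun x => g x + β * x)
      fun i x hx y hy hxy => ?_
    · rwa [breakpoint_zero, breakpoint_last] at this
    · simp only [hg i x hx, hg i y hy]
      nlinarith [hv.neg_le_secondSlope P i]
  wlog h : x ≤ y generalizing x y
  · rw [abs_sub_comm, abs_sub_comm x]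
    exact this hy hx (le_of_not_ge h)
  have h1 := hanti hx hy h
  have h2 := hmono hx hy h
  simp only at h1 h2
  rw [abs_of_nonneg (by linarith), abs_of_nonpos (by linarith)]
  linarith

theorem IsSlopeInterpolant.abs_sub_slope_le (hg : P.IsSlopeInterpolant v g)
    (hv : P.Feasible β v) (hβ : 0 < β) {i : Fin (m + 1)} {x : ℝ} (hx : x ∈ P.cell i) :
    |g x - P.slope v i| ≤ β * P.mesh := by
  rw [← hg.apply_midpoint P]
  refine (hg.abs_sub_le P hv (P.cell_subset i hx)
    ⟨(P.midpoint_mem_Ioo i).1.le, (P.midpoint_mem_Ioo i).2.le⟩).trans ?_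
  gcongr
  have hw := P.width_le_mesh i
  have hp := P.width_pos i
  unfold width at hw hp
  unfold midpoint
  rw [abs_le]
  constructor <;> linarith [hx.1, hx.2]

/-- The interpolant satisfies the Riccati inequality `g' + g² ≤ 0` up to an error of the order of
the mesh size. -/
theorem IsSlopeInterpolant.secondSlope_add_sq_le (hg : P.IsSlopeInterpolant v g)
    (hv : P.Feasible β v) (hβ : 0 < β) (hmesh1 : P.mesh ≤ 1)
    (hmesh : Real.sqrt β * P.mesh ≤ 1) (hmin : P.mesh ≤ 2 * P.minMesh) (i : Fin m) {x : ℝ}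
    (hx : x ∈ Set.Icc (P.breakpoint i.castSucc) (P.breakpoint i.succ)) :
    P.secondSlope v i + g x ^ 2 ≤
      (4 * β * (Real.sqrt β + β) + 4 * Real.sqrt β ^ 3) * P.mesh := by
  have hx01 : x ∈ Set.Icc (0 : ℝ) 1 := by
    have h0 := P.strictMono_breakpoint.monotone (Fin.zero_le i.castSucc)
    have h1 := P.strictMono_breakpoint.monotone (Fin.le_last i.succ)
    rw [breakpoint_zero] at h0
    rw [breakpoint_last] at h1
    exact ⟨h0.trans hx.1, hx.2.trans h1⟩
  have hmid := P.midpoint_succ_sub i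
  have hstep := hv.slope_sub_slope_le P hmesh i
  have hw := P.width_le_mesh i.castSucc
  have hw' := P.width_le_mesh i.succ
  have hp := P.width_pos i.castSucc
  have hp' := P.width_pos i.succ
  have hn := P.minMesh_le_width i.castSucc
  have hn' := P.minMesh_le_width i.succ
  have hb := P.le_breakpoint_castSucc i
  have hb' := P.breakpoint_succ_le i
  have hB : 0 ≤ Real.sqrt β := Real.sqrt_nonneg β
  have hsq : ∀ j : Fin (m + 1), |x - P.midpoint j| ≤ 2 * P.mesh →
      g x ^ 2 - 4 * β * (Real.sqrt β + β) * P.mesh ≤ P.slope v j ^ 2 := by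
    intro j hj
    have h1 := hg.abs_sub_le P hv hx01
      ⟨(P.midpoint_mem_Ioo j).1.le, (P.midpoint_mem_Ioo j).2.le⟩
    rw [hg.apply_midpoint P] at h1
    have h2 : |g x - P.slope v j| ≤ β * (2 * P.mesh) := h1.trans (by gcongr)
    have h3 := hv.abs_slope_le P j
    have h4 : |g x + P.slope v j| ≤ 2 * (Real.sqrt β + β) := by
      calc |g x + P.slope v j| = |(g x - P.slope v j) + 2 * P.slope v j| := by ring_nf
        _ ≤ |g x - P.slope v j| + |2 * P.slope v j| := abs_add_le _ _
        _ ≤ β * (2 * P.mesh) + 2 * Real.sqrt β := by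
            rw [abs_mul, abs_two]
            gcongr
        _ ≤ 2 * (Real.sqrt β + β) := by nlinarith
    have h5 : g x ^ 2 - P.slope v j ^ 2 ≤ β * (2 * P.mesh) * (2 * (Real.sqrt β + β)) := by
      calc g x ^ 2 - P.slope v j ^ 2 = (g x - P.slope v j) * (g x + P.slope v j) := by ring
        _ ≤ |(g x - P.slope v j) * (g x + P.slope v j)| := le_abs_self _
        _ ≤ _ := by
            rw [abs_mul]
            exact mul_le_mul h2 h4 (abs_nonneg _) (by linarith [abs_nonneg (g x - P.slope v j)])
    linarith
  have q := hsq i.castSucc (by rw [abs_le]; constructor <;> linarith [hx.1, hx.2])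
  have q' := hsq i.succ (by rw [abs_le]; constructor <;> linarith [hx.1, hx.2])
  set A := 4 * β * (Real.sqrt β + β) * P.mesh
  have r := mul_le_mul_of_nonneg_right q hp.le
  have r' := mul_le_mul_of_nonneg_right q' hp'.le
  have hH : P.mesh ≤ P.width i.castSucc + P.width i.succ := by linarith
  have hcube : 0 ≤ 2 * Real.sqrt β ^ 3 * P.mesh :=
    mul_nonneg (by positivity) (by linarith)
  have t := mul_le_mul_of_nonneg_left hH hcube
  rw [secondSlope, ← le_sub_iff_add_le, div_le_iff₀ (P.midpoint_lt i), hmid]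
  linarith

end interpolant

end MeshPartition

/-! ### Functions in `𝓔_β` near a feasible vector -/

/-- A continuous `β`-Lipschitz function `G` for which `G e^{∫ G}` decreases is the derivative of a
member of `𝓔_β`, namely of its primitive vanishing at `1/2`. -/
theorem integral_mem_smoothClass {β : ℝ} {G : ℝ → ℝ} (hG : Continuous G)
    (hlip : ∀ x ∈ Set.Icc (0 : ℝ) 1, ∀ y ∈ Set.Icc (0 : ℝ) 1, |G x - G y| ≤ β * |x - y|)
    (hanti : AntitoneOn (fun x => Real.exp (∫ t in (1 / 2)..x, G t) * G x) (Set.Icc 0 1)) :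
    (fun x => ∫ t in (1 / 2)..x, G t) ∈ smoothClass β ∧
      ∀ x ∈ Set.Icc (0 : ℝ) 1, derivUnit (fun x => ∫ t in (1 / 2)..x, G t) x = G x := by
  have hd : ∀ x, HasDerivAt (fun x => ∫ t in (1 / 2 : ℝ)..x, G t) (G x) x := fun x =>
    (hG.integral_hasStrictDerivAt (1 / 2) x).hasDerivAt
  have hdU : ∀ x ∈ Set.Icc (0 : ℝ) 1,
      derivUnit (fun x => ∫ t in (1 / 2 : ℝ)..x, G t) x = G x := fun x hx =>
    (hd x).hasDerivWithinAt.derivWithin (uniqueDiffOn_Icc zero_lt_one x hx)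
  have hderiv : deriv (fun x => ∫ t in (1 / 2 : ℝ)..x, G t) = G := funext fun x => (hd x).deriv
  refine ⟨⟨?_, ?_, by simp, fun x hx y hy => ?_⟩, hdU⟩
  · refine (contDiff_one_iff_deriv.mpr ⟨fun x => (hd x).differentiableAt, ?_⟩).contDiffOn
    rw [hderiv]
    exact hG
  · have he : ∀ x, HasDerivAt (fun x => Real.exp (∫ t in (1 / 2 : ℝ)..x, G t))
        (Real.exp (∫ t in (1 / 2)..x, G t) * G x) x := fun x => (hd x).exp
    refine AntitoneOn.concaveOn_of_deriv (convex_Icc 0 1)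
      (fun x _ => (he x).continuousAt.continuousWithinAt)
      (fun x _ => (he x).differentiableAt.differentiableWithinAt) ?_
    rw [show deriv (fun x => Real.exp (∫ t in (1 / 2 : ℝ)..x, G t)) =
      fun x => Real.exp (∫ t in (1 / 2)..x, G t) * G x from funext fun x => (he x).deriv]
    exact hanti.mono interior_subset
  · rw [hdU x hx, hdU y hy]
    exact hlip x hx y hy

namespace MeshPartition

variable {m : ℕ} (P : MeshPartition m) {β : ℝ} {v : Fin (m + 2) → ℝ}

/-- The approximate Riccati inequality of the interpolated slopes is repaired by a convex
combination with the concave parabola whose derivative is `-b (x - 1/2)`, `b = min β 1`. It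
satisfies `ℓ'' + ℓ'² ≤ -3b/4` and is `β`-smooth. Since `ℓ' ↦ ℓ'' + ℓ'²` is convex, a weight of the
order of the mesh size suffices. -/
theorem exists_mem_smoothClass_near (hβ : 0 < β) : ∃ C ρ : ℝ, β ≤ C ∧ 0 < ρ ∧
    ∀ {m : ℕ} (P : MeshPartition m) (v : Fin (m + 2) → ℝ), P.mesh ≤ ρ → P.mesh ≤ 2 * P.minMesh →
      P.Feasible β v → ∃ l ∈ smoothClass β,
        ∀ i, ∀ x ∈ P.cell i, |derivUnit l x - P.slope v i| ≤ C * P.mesh := by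
  set B := Real.sqrt β with hBdef
  have hB : 0 < B := Real.sqrt_pos.mpr hβ
  set C₁ := 4 * β * (B + β) + 4 * B ^ 3 with hC₁
  have hC₁0 : 0 < C₁ := by positivity
  set b := min β 1 with hb
  have hb0 : 0 < b := lt_min hβ one_pos
  have hbβ : b ≤ β := min_le_left _ _
  have hb1 : b ≤ 1 := min_le_right _ _
  refine ⟨β + 2 * C₁ / b * (B + β + b), min 1 (min (1 / B) (b / (2 * C₁))), ?_, by positivity, ?_⟩
  · have : 0 ≤ 2 * C₁ / b * (B + β + b) := by positivity
    linarith
  intro m P v hρ hmin hv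
  set δ := P.mesh with hδ
  have hδ1 : δ ≤ 1 := hρ.trans (min_le_left _ _)
  have hδB : B * δ ≤ 1 := by
    have : δ ≤ 1 / B := hρ.trans ((min_le_right _ _).trans (min_le_left _ _))
    rwa [le_div_iff₀ hB, mul_comm] at this
  have hδb : δ ≤ b / (2 * C₁) := hρ.trans ((min_le_right _ _).trans (min_le_right _ _))
  have hδ0 : 0 < δ := P.minMesh_pos.trans_le P.minMesh_le_mesh
  obtain ⟨ε, hε⟩ : ∃ ε, ε = 2 * C₁ / b * δ := ⟨_, rfl⟩
  have hε0 : 0 ≤ ε := by rw [hε]; positivity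
  have hε1 : ε ≤ 1 := by
    rw [le_div_iff₀ (by positivity)] at hδb
    rw [hε, div_mul_eq_mul_div, div_le_one hb0]
    linarith
  have hεb : ε * b = 2 * C₁ * δ := by
    rw [hε]
    field_simp
  obtain ⟨g, hg⟩ := P.exists_isSlopeInterpolant v
  have hglip : ∀ x ∈ Set.Icc (0 : ℝ) 1, ∀ y ∈ Set.Icc (0 : ℝ) 1, |g x - g y| ≤ β * |x - y| :=
    fun x hx y hy => hg.abs_sub_le P hv hx hy
  -- `g` is only controlled on `[0, 1]`; extend it continuously to the line.
  have hgcont : Continuous (Set.IccExtend (zero_le_one (α := ℝ)) fun x => g x) := by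
    refine Continuous.Icc_extend' ?_
    refine (LipschitzWith.of_dist_le_mul (K := β.toNNReal) fun x y => ?_).continuous
    rw [Real.coe_toNNReal _ hβ.le, Real.dist_eq]
    exact hglip x x.2 y y.2
  set G : ℝ → ℝ := fun x =>
    (1 - ε) * Set.IccExtend (zero_le_one (α := ℝ)) (fun x => g x) x - ε * (b * (x - 1 / 2))
    with hGdef
  have hGcont : Continuous G := by
    refine (hgcont.const_mul _).sub ?_
    fun_prop
  have hGeq : ∀ x ∈ Set.Icc (0 : ℝ) 1, G x = (1 - ε) * g x - ε * (b * (x - 1 / 2)) := by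
    intro x hx
    rw [hGdef]
    simp only
    rw [Set.IccExtend_of_mem _ _ hx]
  have hGlip : ∀ x ∈ Set.Icc (0 : ℝ) 1, ∀ y ∈ Set.Icc (0 : ℝ) 1, |G x - G y| ≤ β * |x - y| := by
    intro x hx y hy
    rw [hGeq x hx, hGeq y hy]
    calc |(1 - ε) * g x - ε * (b * (x - 1 / 2)) - ((1 - ε) * g y - ε * (b * (y - 1 / 2)))|
        = |(1 - ε) * (g x - g y) - ε * b * (x - y)| := by ring_nf
      _ ≤ |(1 - ε) * (g x - g y)| + |ε * b * (x - y)| := abs_sub _ _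
      _ = (1 - ε) * |g x - g y| + ε * b * |x - y| := by
          rw [abs_mul, abs_mul, abs_of_nonneg (sub_nonneg.mpr hε1),
            abs_of_nonneg (mul_nonneg hε0 hb0.le)]
      _ ≤ (1 - ε) * (β * |x - y|) + ε * β * |x - y| := by
          have := sub_nonneg.mpr hε1
          gcongr
          exact hglip x hx y hy
      _ = β * |x - y| := by ring
  have hanti : AntitoneOn (fun x => Real.exp (∫ t in (1 / 2)..x, G t) * G x) (Set.Icc 0 1) := by
    suffices MonotoneOn (fun x => -(Real.exp (∫ t in (1 / 2)..x, G t) * G x)) (Set.Icc 0 1) from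
      fun x hx y hy hxy => neg_le_neg_iff.mp (this hx hy hxy)
    have := monotoneOn_of_pieces P.strictMono_breakpoint.monotone
      (f := fun x => -(Real.exp (∫ t in (1 / 2)..x, G t) * G x)) fun i => ?_
    · rwa [breakpoint_zero, breakpoint_last] at this
    have hsub : Set.Icc (P.breakpoint i.castSucc) (P.breakpoint i.succ) ⊆ Set.Icc 0 1 := by
      have h0 := P.strictMono_breakpoint.monotone (Fin.zero_le i.castSucc)
      have h1 := P.strictMono_breakpoint.monotone (Fin.le_last i.succ)
      rw [breakpoint_zero] at h0
      rw [breakpoint_last] at h1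
      exact Set.Icc_subset_Icc h0 h1
    have hGd : ∀ x ∈ Set.Icc (P.breakpoint i.castSucc) (P.breakpoint i.succ),
        HasDerivWithinAt G ((1 - ε) * P.secondSlope v i - ε * b)
          (Set.Icc (P.breakpoint i.castSucc) (P.breakpoint i.succ)) x := by
      intro x hx
      have h1 : HasDerivAt (fun x => (1 - ε) * (P.slope v i.castSucc +
          P.secondSlope v i * (x - P.midpoint i.castSucc)) - ε * (b * (x - 1 / 2)))
          ((1 - ε) * P.secondSlope v i - ε * b) x := by
        have h2 := ((((hasDerivAt_id x).sub_const (P.midpoint i.castSucc)).const_mul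
          (P.secondSlope v i)).const_add (P.slope v i.castSucc)).const_mul (1 - ε)
        have h3 := ((((hasDerivAt_id x).sub_const (1 / 2)).const_mul b)).const_mul ε
        exact (h2.sub h3).congr_deriv (by ring)
      refine h1.hasDerivWithinAt.congr (fun y hy => ?_) ?_
      · rw [hGeq y (hsub hy), hg i y hy]
      · rw [hGeq x (hsub hx), hg i x hx]
    have hd : ∀ x ∈ Set.Icc (P.breakpoint i.castSucc) (P.breakpoint i.succ),
        HasDerivWithinAt (fun x => -(Real.exp (∫ t in (1 / 2)..x, G t) * G x))
          (-(Real.exp (∫ t in (1 / 2)..x, G t) * G x * G x + Real.exp (∫ t in (1 / 2)..x, G t) *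
            ((1 - ε) * P.secondSlope v i - ε * b)))
          (Set.Icc (P.breakpoint i.castSucc) (P.breakpoint i.succ)) x := fun x hx =>
      (((hGcont.integral_hasStrictDerivAt (1 / 2) x).hasDerivAt.exp.hasDerivWithinAt).mul
        (hGd x hx)).neg
    refine monotoneOn_of_hasDerivWithinAt_nonneg (convex_Icc _ _)
      (fun x hx => (hd x hx).continuousWithinAt)
      (fun x hx => (hd x (interior_subset hx)).mono interior_subset) fun x hx => ?_
    have hx := interior_subset hx
    have hric := hg.secondSlope_add_sq_le P hv hβ hδ1 hδB hmin i hx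
    have hx01 := hsub hx
    have hq : (b * (x - 1 / 2)) ^ 2 ≤ b / 4 := by
      have h1 : (x - 1 / 2) ^ 2 ≤ 1 / 4 := by nlinarith [hx01.1, hx01.2]
      calc (b * (x - 1 / 2)) ^ 2 = b * (b * (x - 1 / 2) ^ 2) := by ring
        _ ≤ b * (1 * (1 / 4)) := by gcongr
        _ = b / 4 := by ring
    have hconv : ((1 - ε) * g x - ε * (b * (x - 1 / 2))) ^ 2 ≤
        (1 - ε) * g x ^ 2 + ε * (b * (x - 1 / 2)) ^ 2 := by
      have : 0 ≤ ε * (1 - ε) * (g x + b * (x - 1 / 2)) ^ 2 :=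
        mul_nonneg (mul_nonneg hε0 (sub_nonneg.mpr hε1)) (sq_nonneg _)
      linarith
    have h1 := mul_le_mul_of_nonneg_left hric (sub_nonneg.mpr hε1)
    have h2 := mul_le_mul_of_nonneg_left hq hε0
    have h3 : 0 ≤ ε * (C₁ * δ) := by positivity
    have h4 : 0 ≤ C₁ * δ := by positivity
    have hfin : (1 - ε) * P.secondSlope v i - ε * b + G x ^ 2 ≤ 0 := by
      rw [hGeq x hx01]
      linarith
    have hE := Real.exp_pos (∫ t in (1 / 2)..x, G t)
    have := mul_nonpos_of_nonneg_of_nonpos hE.le hfin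
    linarith
  obtain ⟨hmem, hder⟩ := integral_mem_smoothClass hGcont hGlip hanti
  refine ⟨_, hmem, fun i x hx => ?_⟩
  have hx01 := P.cell_subset i hx
  rw [hder x hx01, hGeq x hx01]
  have h1 := hg.abs_sub_slope_le P hv hβ hx
  have h2 := hv.abs_slope_le P i
  have h3 : |g x| ≤ B + β := by
    calc |g x| = |(g x - P.slope v i) + P.slope v i| := by ring_nf
      _ ≤ |g x - P.slope v i| + |P.slope v i| := abs_add_le _ _
      _ ≤ β * 1 + B := by
          refine add_le_add (h1.trans ?_) h2
          gcongr
      _ = B + β := by ring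
  have h4 : |b * (x - 1 / 2)| ≤ b := by
    rw [abs_mul, abs_of_pos hb0]
    have : |x - 1 / 2| ≤ 1 := by
      rw [abs_le]
      constructor <;> linarith [hx01.1, hx01.2]
    nlinarith
  calc |(1 - ε) * g x - ε * (b * (x - 1 / 2)) - P.slope v i|
      = |(g x - P.slope v i) - ε * (g x + b * (x - 1 / 2))| := by ring_nf
    _ ≤ |g x - P.slope v i| + |ε * (g x + b * (x - 1 / 2))| := abs_sub _ _
    _ ≤ β * δ + ε * (B + β + b) := by
        rw [abs_mul, abs_of_nonneg hε0]
        gcongr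
        exact (abs_add_le _ _).trans (add_le_add h3 h4)
    _ = (β + 2 * C₁ / b * (B + β + b)) * δ := by
        rw [hε]
        ring

/-! ### The discretized objective -/

/-- Inside the cells a selection is forced, and there are only finitely many nodes. -/
theorem measurableSet_cellSelection_eq {c : ℝ → Fin (m + 1)} (hc : P.IsCellSelection c)
    (i : Fin (m + 1)) : MeasurableSet {x | x ∈ Set.Icc (0 : ℝ) 1 ∧ c x = i} := by
  have heq : {x | x ∈ Set.Icc (0 : ℝ) 1 ∧ c x = i} =
      Set.Ioo (P.node i.castSucc) (P.node i.succ) ∪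
        ({x | x ∈ Set.Icc (0 : ℝ) 1 ∧ c x = i} ∩ Set.range P.node) := by
    ext x
    constructor
    · rintro ⟨hx, hi⟩
      have hcell := hc x hx
      rw [hi] at hcell
      rcases hcell.1.eq_or_lt with h0 | h0
      · exact Or.inr ⟨⟨hx, hi⟩, _, h0⟩
      rcases hcell.2.eq_or_lt with h1 | h1
      · exact Or.inr ⟨⟨hx, hi⟩, _, h1.symm⟩
      exact Or.inl ⟨h0, h1⟩
    · rintro (hx | hx)
      · have hx01 : x ∈ Set.Icc (0 : ℝ) 1 := P.cell_subset i ⟨hx.1.le, hx.2.le⟩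
        refine ⟨hx01, ?_⟩
        have hcell := hc x hx01
        rcases lt_trichotomy (c x) i with h | h | h
        · have hle : (c x).succ ≤ i.castSucc := h
          exact absurd (hcell.2.trans (P.strictMono_node.monotone hle)) (not_le.mpr hx.1)
        · exact h
        · have hle : i.succ ≤ (c x).castSucc := h
          exact absurd ((P.strictMono_node.monotone hle).trans hcell.1) (not_le.mpr hx.2)
      · exact hx.1
  rw [heq]
  exact measurableSet_Ioo.union ((Set.finite_range P.node).inter_of_right _).measurableSet

theorem measurable_indicator_cellSelection {c : ℝ → Fin (m + 1)} (hc : P.IsCellSelection c)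
    {F : Fin (m + 1) → ℝ → ℝ} (hF : ∀ i, Measurable (F i)) :
    Measurable ((Set.Icc (0 : ℝ) 1).indicator fun x => F (c x) x) := by
  have heq : ((Set.Icc (0 : ℝ) 1).indicator fun x => F (c x) x) =
      fun x => ∑ i, {x | x ∈ Set.Icc (0 : ℝ) 1 ∧ c x = i}.indicator (F i) x := by
    funext x
    by_cases hx : x ∈ Set.Icc (0 : ℝ) 1
    · rw [Set.indicator_of_mem hx, Finset.sum_eq_single (c x)]
      · rw [Set.indicator_of_mem (show x ∈ {y | y ∈ Set.Icc (0 : ℝ) 1 ∧ c y = c x} from ⟨hx, rfl⟩)]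
      · intro i _ hi
        exact Set.indicator_of_notMem (fun h => hi h.2.symm) _
      · exact fun h => absurd (Finset.mem_univ _) h
    · rw [Set.indicator_of_notMem hx]
      exact (Finset.sum_eq_zero fun i _ => Set.indicator_of_notMem (fun h => hx h.1) _).symm
  rw [heq]
  exact Finset.measurable_sum _ fun i _ =>
    (hF i).indicator (P.measurableSet_cellSelection_eq hc i)

theorem measurable_indicator_interp (v : Fin (m + 2) → ℝ) :
    Measurable ((Set.Icc (0 : ℝ) 1).indicator (P.interp v)) :=
  P.measurable_indicator_cellSelection P.isCellSelection_rightCell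
    (F := fun i x => v i.castSucc + P.slope v i * (x - P.node i.castSucc)) fun i => by fun_prop

theorem measurable_indicator_interpDeriv {c : ℝ → Fin (m + 1)} (hc : P.IsCellSelection c)
    (v : Fin (m + 2) → ℝ) : Measurable ((Set.Icc (0 : ℝ) 1).indicator (P.interpDeriv c v)) :=
  P.measurable_indicator_cellSelection hc (F := fun i _ => P.slope v i) fun _ => measurable_const

theorem Feasible.abs_interp_le (hv : P.Feasible β v) {x : ℝ} (hx : x ∈ Set.Icc (0 : ℝ) 1) :
    |P.interp v x| ≤ Real.sqrt β := by
  have := P.abs_sub_interp_le (l := fun _ => 0) (dl := fun _ => 0) (v := v) (D := Real.sqrt β)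
    (fun x _ => hasDerivWithinAt_const _ _ _) rfl hv.2.2.2.2
    (fun i x _ => by simpa using hv.abs_slope_le P i) hx
  simpa using this

/-- The tangent bounds of a nearby member of `𝓔_β` pass to a feasible vector with half the
constant. -/
theorem Feasible.isAdmissible (hv : P.Feasible β v) (hβ : 0 < β) {c : ℝ → Fin (m + 1)}
    (hc : P.IsCellSelection c) {l : ℝ → ℝ} (hl : l ∈ smoothClass β) {D : ℝ}
    (hD : ∀ i, ∀ x ∈ P.cell i, |derivUnit l x - P.slope v i| ≤ D)
    (hDle : D ≤ Real.exp (-Real.sqrt β) / 2) :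
    IsAdmissible (Real.sqrt β) (Real.exp (-Real.sqrt β) / 2) (P.interp v) (P.interpDeriv c v) := by
  have hadm := isAdmissible_of_mem_smoothClass hl hβ
  refine ⟨fun x hx => hv.abs_interp_le P hx, fun x _ => hv.abs_slope_le P _, fun x hx => ?_,
    fun x hx => ?_⟩
  · have h1 := abs_le.mp (hD _ x (hc x hx))
    have h2 := hadm.le_tangent_zero x hx
    unfold interpDeriv
    nlinarith [h1.1, h1.2, hx.1, hx.2]
  · have h1 := abs_le.mp (hD _ x (hc x hx))
    have h2 := hadm.le_tangent_one x hx
    unfold interpDeriv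
    nlinarith [h1.1, h1.2, hx.1, hx.2]

theorem continuous_slope (i : Fin (m + 1)) : Continuous fun v => P.slope v i := by
  unfold slope
  fun_prop

theorem continuous_interp (x : ℝ) : Continuous fun v => P.interp v x := by
  unfold interp
  have := P.continuous_slope (P.rightCell x)
  fun_prop

theorem isCompact_feasible (β : ℝ) : IsCompact {v | P.Feasible β v} := by
  refine Metric.isCompact_of_isClosed_isBounded ?_ ?_
  · have hs := P.continuous_slope
    simp only [Feasible, Set.ofPred_and, Set.ofPred_forall]
    refine IsClosed.inter ?_ (IsClosed.inter ?_ (IsClosed.inter ?_ (IsClosed.inter ?_ ?_)))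
    · refine isClosed_iInter fun i => isClosed_le ?_ continuous_const
      have hab : P.node i.castSucc.castSucc < P.node i.succ.castSucc :=
        P.strictMono_node Fin.castSucc_lt_succ
      have hbc : P.node i.succ.castSucc < P.node i.succ.succ :=
        P.strictMono_node Fin.castSucc_lt_succ
      set a := P.node i.castSucc.castSucc
      set b := P.node i.succ.castSucc
      set c := P.node i.succ.succ
      have hac : 0 < c - a := by linarith
      have hw0 : 0 < (b - a) / (c - a) := div_pos (by linarith) hac
      have hw1 : 0 < 1 - (b - a) / (c - a) := by
        rw [sub_pos, div_lt_one hac]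
        linarith
      refine Continuous.add (by fun_prop) (Continuous.log (by fun_prop) fun v => ?_)
      positivity
    · exact isClosed_iInter fun i =>
        isClosed_le (((hs _).sub (hs _)).neg.sub continuous_const) continuous_const
    · exact isClosed_le (((hs _).pow 2).sub continuous_const) continuous_const
    · exact isClosed_le (((hs _).pow 2).sub continuous_const) continuous_const
    · exact isClosed_eq (P.continuous_interp _) continuous_const
  · refine (Metric.isBounded_closedBall (x := (0 : Fin (m + 2) → ℝ)) (r := Real.sqrt β)).subset
      fun v hv => ?_
    rw [mem_closedBall_zero_iff, pi_norm_le_iff_of_nonneg (Real.sqrt_nonneg _)]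
    intro j
    rw [Real.norm_eq_abs, ← P.interp_node v j]
    exact Feasible.abs_interp_le P hv (P.node_mem_Icc j)

theorem exists_isOptimizer (hβ : 0 < β) {η₀ η₁ : ℝ} (hη₁ : 0 ≤ η₁)
    (γ : Measure (DataSpace n)) [IsProbabilityMeasure γ] {c : ℝ → Fin (m + 1)}
    (hc : P.IsCellSelection c) {B κ : ℝ} (hκ : 0 < κ)
    (hadm : ∀ v, P.Feasible β v → IsAdmissible B κ (P.interp v) (P.interpDeriv c v)) :
    ∃ v, P.IsOptimizer c β η₀ η₁ γ v := by
  have hcont : ContinuousOn (P.discreteObjective c η₀ η₁ γ) {v | P.Feasible β v} := by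
    refine continuousOn_of_dominated (bound := fun _ => |η₀| * (2 * B) + η₁ * (2 * B / κ))
      (fun v _ => (measurable_reward (P.measurable_indicator_interp v)
        (P.measurable_indicator_interpDeriv hc v)).aestronglyMeasurable)
      (fun v hv => Filter.Eventually.of_forall fun z => ?_) (integrable_const _)
      (Filter.Eventually.of_forall fun z => ?_)
    · rw [Real.norm_eq_abs]
      exact (hadm v hv).abs_reward_le hκ hη₁ z
    · have hi := P.continuous_interp
      have hd : ∀ x, Continuous fun v => P.interpDeriv c v x := fun x => P.continuous_slope _
      have hG : Continuous fun v =>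
          grossReturn (P.interpDeriv c v) (z.1 : Fin n → ℝ) (z.2 : Fin n → ℝ) := by
        unfold grossReturn portfolio
        fun_prop
      have hD : Continuous fun v => diversity (P.interp v)
          (aitchisonAdd (z.1 : Fin n → ℝ) (z.2 : Fin n → ℝ)) (z.1 : Fin n → ℝ) := by
        unfold diversity
        fun_prop
      unfold reward logReturn
      refine (hD.const_mul _).continuousOn.add (ContinuousOn.const_mul
        (hG.continuousOn.log fun v hv => ?_) _)
      exact (hκ.trans_le (le_grossReturn z.1.2.1 z.2.2 (hadm v hv).le_tangent_zero
        (hadm v hv).le_tangent_one)).ne'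
  obtain ⟨v, hv, hmax⟩ := (P.isCompact_feasible β).exists_isMaxOn
    ⟨fun _ => 0, Set.mem_ofPred.mpr
      (P.feasible_of_mem_smoothClass (zero_mem_smoothClass hβ) hβ)⟩ hcont
  exact ⟨v, hv, fun w hw => hmax hw⟩

end MeshPartition

end RankPortfolio

theorem theorem4 (n : ℕ) (hn : 2 ≤ n) (β : ℝ) (hβ : 0 < β) (M : ℝ) (hM : 0 < M) :
    ∃ δ₀ : ℝ → ℝ, (∀ α : ℝ, 0 < α → α < 1 → 0 < δ₀ α) ∧
      ∀ η₀ η₁ : ℝ, 0 < η₁ → ∃ K : ℝ, 0 < K ∧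
        ∀ α : ℝ, 0 < α → α < 1 →
        ∀ γ : MeasureTheory.Measure (DataSpace n), MeasureTheory.IsProbabilityMeasure γ →
        ∀ (m : ℕ) (P : MeshPartition m) (c : ℝ → Fin (m + 1)), P.IsCellSelection c →
          |P.mesh - P.minMesh| ≤ M * P.minMesh ^ 3 → P.minMesh < δ₀ α →
            -- both objectives are genuinely defined on their feasible sets
            (∀ l ∈ smoothClass β, ObjectiveDefined η₀ η₁ γ l (derivUnit l)) ∧
            (∀ v, P.Feasible β v → ObjectiveDefined η₀ η₁ γ (P.interp v) (P.interpDeriv c v)) ∧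
            -- the supremum defining the optimal value is finite; the discretized one is attained
            IsLUB (continuousValues β η₀ η₁ γ) (optimalValue β η₀ η₁ γ) ∧
            (∃ v, P.IsOptimizer c β η₀ η₁ γ v) ∧
            -- the error estimate, for every optimal solution of the discretized problem
            ∀ v, P.IsOptimizer c β η₀ η₁ γ v →
              |optimalValue β η₀ η₁ γ - P.discreteObjective c η₀ η₁ γ v| ≤ K * P.minMesh ^ α ∧
              K * P.minMesh ^ α ≤ K * P.mesh ^ α := by
  obtain ⟨C, ρ, hβC, hρ, hnear⟩ := MeshPartition.exists_mem_smoothClass_near hβ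
  have hC : 0 < C := hβ.trans_le hβC
  set κ := Real.exp (-Real.sqrt β) / 2 with hκdef
  have hκ : 0 < κ := by positivity
  have hκle : κ ≤ Real.exp (-Real.sqrt β) := half_le_self (Real.exp_pos _).le
  refine ⟨fun _ => min (min 1 (1 / M)) (min ρ (κ / C) / 2), fun _ _ _ => by positivity,
    fun η₀ η₁ hη₁ => ?_⟩
  set L := (|η₀| * 2 + η₁ * 2 / κ) * C with hL
  have hL0 : 0 < L := by positivity
  refine ⟨2 * L, by positivity, fun α hα hα1 γ hγ m P c hc hquasi hsmall => ?_⟩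
  have hd0 := P.minMesh_pos
  have hd1 : P.minMesh < 1 := hsmall.trans_le ((min_le_left _ _).trans (min_le_left _ _))
  have hdM : M * P.minMesh ≤ 1 := by
    have := hsmall.le.trans ((min_le_left _ _).trans (min_le_right _ _))
    rwa [le_div_iff₀ hM, mul_comm] at this
  have hmesh2 : P.mesh ≤ 2 * P.minMesh := by
    have h1 := (abs_le.mp hquasi).2
    have h2 : M * P.minMesh ^ 3 ≤ P.minMesh := by
      calc M * P.minMesh ^ 3 = (M * P.minMesh) * (P.minMesh * P.minMesh) := by ring
        _ ≤ 1 * (1 * P.minMesh) := by gcongr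
        _ = P.minMesh := by ring
    linarith
  have hmeshle : P.mesh ≤ min ρ (κ / C) := by
    have := hsmall.le.trans (min_le_right _ _)
    linarith
  have hmeshρ := hmeshle.trans (min_le_left _ _)
  have hmeshκ : C * P.mesh ≤ κ := by
    have := hmeshle.trans (min_le_right _ _)
    rwa [le_div_iff₀ hC, mul_comm] at this
  have hadm : ∀ v, P.Feasible β v → IsAdmissible (Real.sqrt β) κ (P.interp v)
      (P.interpDeriv c v) := by
    intro v hv
    obtain ⟨l, hl, hclose⟩ := hnear P v hmeshρ hmesh2 hv
    exact hv.isAdmissible P hβ hc hl hclose hmeshκ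
  have hdefc : ∀ l ∈ smoothClass β, ObjectiveDefined η₀ η₁ γ l (derivUnit l) := fun l hl =>
    objectiveDefined_of_mem_smoothClass hl hβ hη₁.le γ
  have hdefd : ∀ v, P.Feasible β v →
      ObjectiveDefined η₀ η₁ γ (P.interp v) (P.interpDeriv c v) := fun v hv =>
    (hadm v hv).objectiveDefined hκ hη₁.le (P.measurable_indicator_interp v)
      (P.measurable_indicator_interpDeriv hc v) γ
  have hlub := isLUB_optimalValue (n := n) hβ (η₀ := η₀) hη₁.le γ
  -- Two feasible functions with `C δ`-close derivatives have objectives within `L δ`.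
  have hdiff : ∀ l ∈ smoothClass β, ∀ v, P.Feasible β v →
      (∀ i, ∀ x ∈ P.cell i, |derivUnit l x - P.slope v i| ≤ C * P.mesh) →
      |continuousObjective η₀ η₁ γ l - P.discreteObjective c η₀ η₁ γ v| ≤ L * P.mesh := by
    intro l hl v hv hclose
    have := abs_objective_sub_le γ hκ hη₁.le ((isAdmissible_of_mem_smoothClass hl hβ).mono hκle)
      (hadm v hv) (hdefc l hl) (hdefd v hv)
      (fun x hx => P.abs_sub_interp_le (fun y hy => hasDerivWithinAt_of_mem_smoothClass hl hy)
        hl.2.2.1 hv.2.2.2.2 hclose hx)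
      (fun x hx => hclose _ x (hc x hx))
    refine this.trans (le_of_eq ?_)
    rw [hL]
    ring
  refine ⟨hdefc, hdefd, hlub, P.exists_isOptimizer hβ hη₁.le γ hc hκ hadm, fun v hv => ⟨?_, ?_⟩⟩
  · have hmain : |optimalValue β η₀ η₁ γ - P.discreteObjective c η₀ η₁ γ v| ≤ L * P.mesh := by
      rw [abs_le]
      constructor
      · obtain ⟨l, hl, hclose⟩ := hnear P v hmeshρ hmesh2 hv.1
        have h1 := (abs_le.mp (hdiff l hl v hv.1 hclose)).1
        have h2 := hlub.1 ⟨l, hl, rfl⟩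
        linarith
      · rw [sub_le_iff_le_add]
        refine hlub.2 ?_
        rintro _ ⟨l, hl, rfl⟩
        have hf := P.feasible_of_mem_smoothClass hl hβ
        have h1 := (abs_le.mp (hdiff l hl _ hf fun i x hx =>
          (P.abs_derivUnit_sub_slope_le hl hβ hx).trans (by
            have := hd0.trans_le P.minMesh_le_mesh
            gcongr))).2
        have h2 := hv.2 _ hf
        linarith
    have hpow : P.minMesh ≤ P.minMesh ^ α := by
      have := Real.rpow_le_rpow_of_exponent_ge hd0 hd1.le hα1.le
      rwa [Real.rpow_one] at this
    calc _ ≤ L * P.mesh := hmain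
      _ ≤ L * (2 * P.minMesh) := by gcongr
      _ ≤ L * (2 * P.minMesh ^ α) := by gcongr
      _ = 2 * L * P.minMesh ^ α := by ring
  · have := P.minMesh_le_mesh
    gcongr
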